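/- Let $n\ge 1$, $\hbar>0$ and $h=2\pi\hbar$. Let $M$ be a real symmetric positive definite $2n\times 2n$ matrix and let $\rho$ be a smooth real-valued integrable function on $\mathbb{R}^{2n}$ (with points $z=(x,p)$) such that $\int\rho(z)\,dz=1$ and $$\rho(z)\le C e^{-\frac{1}{\hbar}Mz\cdot z}\qquad(z\in\mathbb{R}^{2n})$$ for some constant $C\ge 0$. Consider the ellipsoid $\mathcal{B}_M=\{z: Mz\cdot z\le\hbar\}$ and let $c$ be a symplectic capacity on $\mathbb{R}^{2n}$ (a linear one suffices), that is, a map from the subsets of $\mathbb{R}^{2n}$ to $[0,\infty]$ that is invariant under linear symplectic maps, is monotone for inclusion, satisfies $c(t\,\Omega)=t^2c(\Omega)$ for $t\in\mathbb{R}$, and satisfies $c(B(r))=c(Z_j(r))=\pi r^2$ for the balls $B(r)=\{|z|\le r\}$ and the cylinders $Z_j(r)=\{x_j^2+p_j^2\le r^2\}$, $r\ge0$, $1\le j\le n$. If $c(\mathcal{B}_M)<\frac12 h$, then $\rho$ is not the Wigner distribution of any quantum state: there is no density operator $\widehat\rho$ on $L^2(\mathbb{R}^n)$ (a positive trace class operator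 of trace one) such that, for every $\psi\in L^2(\mathbb{R}^n)$, $$\widehat\rho\,\psi(x)=\int\!\!\int e^{\frac{i}{\hbar}p\cdot(x-y)}\rho\left(\tfrac12(x+y),p\right)\psi(y)\,dy\,dp\qquad\text{for almost every }x .$$ -/

import Mathlib

open MeasureTheory
open scoped ENNReal ContDiff Matrix Pointwise

/-- The phase space `ℝ²ⁿ` with points `z = (x, p)`: the coordinates `x` have the indices `Sum.inl j`
and the coordinates `p` the indices `Sum.inr j`. -/
abbrev PhaseSpace (n : ℕ) : Type := Fin n ⊕ Fin n → ℝ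

/-- The point `(x, p)` of phase space. -/
def phasePoint {n : ℕ} (x p : Fin n → ℝ) : PhaseSpace n := Sum.elim x p

/-- The quadratic form `z ↦ M z · z`. -/
def quadForm {n : ℕ} (M : Matrix (Fin n ⊕ Fin n) (Fin n ⊕ Fin n) ℝ) (z : PhaseSpace n) : ℝ :=
  (M *ᵥ z) ⬝ᵥ z

/-- The closed Euclidean ball `B(r) : |z| ≤ r` in phase space. -/
def phaseBall (n : ℕ) (r : ℝ) : Set (PhaseSpace n) := {z | z ⬝ᵥ z ≤ r ^ 2}

/-- The cylinder `Z_j(r) : x_j² + p_j² ≤ r²` in phase space. -/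
def phaseCylinder {n : ℕ} (j : Fin n) (r : ℝ) : Set (PhaseSpace n) :=
  {z | z (Sum.inl j) ^ 2 + z (Sum.inr j) ^ 2 ≤ r ^ 2}

/-- The ellipsoid `M z · z ≤ ħ` in phase space. -/
def phaseEllipsoid {n : ℕ} (ħ : ℝ) (M : Matrix (Fin n ⊕ Fin n) (Fin n ⊕ Fin n) ℝ) :
    Set (PhaseSpace n) :=
  {z | quadForm M z ≤ ħ}

/-- Linear symplectic capacities on `ℝ²ⁿ`: invariance is required under linear symplectic maps only.
Thus every symplectic capacity, invariant under all symplectomorphisms, is one of them. -/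
structure IsLinearSymplecticCapacity {n : ℕ} (c : Set (PhaseSpace n) → ℝ≥0∞) : Prop where
  /-- invariance under linear symplectic maps -/
  image_eq : ∀ S ∈ Matrix.symplecticGroup (Fin n) ℝ, ∀ Ω : Set (PhaseSpace n),
    c ((fun z => S *ᵥ z) '' Ω) = c Ω
  /-- monotonicity -/
  mono : ∀ Ω Ω' : Set (PhaseSpace n), Ω ⊆ Ω' → c Ω ≤ c Ω'
  /-- conformality -/
  smul_eq : ∀ (t : ℝ) (Ω : Set (PhaseSpace n)), c (t • Ω) = ENNReal.ofReal (t ^ 2) * c Ω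
  /-- normalization on balls -/
  ball_eq : ∀ r : ℝ, 0 ≤ r → c (phaseBall n r) = ENNReal.ofReal (Real.pi * r ^ 2)
  /-- normalization on cylinders -/
  cylinder_eq : ∀ (j : Fin n) (r : ℝ), 0 ≤ r →
    c (phaseCylinder j r) = ENNReal.ofReal (Real.pi * r ^ 2)

/-- The capacity `c_lin(Ω)`: the supremum of `π R²` over all balls `B(R)` that some affine symplectic
map `z ↦ S z + v` sends into `Ω`. -/
noncomputable def linearCapacity {n : ℕ} (Ω : Set (PhaseSpace n)) : ℝ≥0∞ :=
  ⨆ (R : ℝ) (_ : 0 ≤ R ∧ ∃ S ∈ Matrix.symplecticGroup (Fin n) ℝ, ∃ v : PhaseSpace n,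
    ∀ z ∈ phaseBall n R, S *ᵥ z + v ∈ Ω), ENNReal.ofReal (Real.pi * R ^ 2)

lemma linearCapacity_mono {n : ℕ} {Ω Ω' : Set (PhaseSpace n)} (h : Ω ⊆ Ω') :
    linearCapacity Ω ≤ linearCapacity Ω' := by
  refine iSup₂_le fun R hR => ?_
  obtain ⟨h0, S, hS, v, hv⟩ := hR
  exact le_iSup₂_of_le R ⟨h0, S, hS, v, fun z hz => h (hv z hz)⟩ le_rfl

lemma linearCapacity_image_le {n : ℕ} {S : Matrix (Fin n ⊕ Fin n) (Fin n ⊕ Fin n) ℝ}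
    (hS : S ∈ Matrix.symplecticGroup (Fin n) ℝ) (Ω : Set (PhaseSpace n)) :
    linearCapacity Ω ≤ linearCapacity ((fun z => S *ᵥ z) '' Ω) := by
  refine iSup₂_le fun R hR => ?_
  obtain ⟨h0, A, hA, v, hv⟩ := hR
  refine le_iSup₂_of_le R ⟨h0, S * A, mul_mem hS hA, S *ᵥ v, fun z hz => ?_⟩ le_rfl
  exact ⟨_, hv z hz, by simp [Matrix.mulVec_add, Matrix.mulVec_mulVec]⟩

lemma linearCapacity_smul_le {n : ℕ} {t : ℝ} (ht : t ≠ 0) (Ω : Set (PhaseSpace n)) :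
    ENNReal.ofReal (t ^ 2) * linearCapacity Ω ≤ linearCapacity (t • Ω) := by
  unfold linearCapacity
  simp only [ENNReal.mul_iSup]
  refine iSup₂_le fun R hR => ?_
  obtain ⟨h0, A, hA, v, hv⟩ := hR
  refine le_iSup₂_of_le (|t| * R) ⟨by positivity, A, hA, t • v, fun z hz => ?_⟩ ?_
  · have hz' : t⁻¹ • z ∈ phaseBall n R := by
      simp only [phaseBall, Set.mem_ofPred_eq, smul_dotProduct, dotProduct_smul,
        smul_eq_mul] at hz ⊢
      rw [mul_pow, sq_abs] at hz
      have h2 : 0 < t ^ 2 := by positivity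
      have : t⁻¹ * (t⁻¹ * z ⬝ᵥ z) = (z ⬝ᵥ z) / t ^ 2 := by field_simp
      rw [this, div_le_iff₀ h2]
      linarith
    refine Set.mem_smul_set.2 ⟨_, hv _ hz', ?_⟩
    rw [smul_add, Matrix.mulVec_smul, smul_smul, mul_inv_cancel₀ ht, one_smul]
  · rw [← ENNReal.ofReal_mul (by positivity), mul_pow, sq_abs]
    apply le_of_eq
    congr 1
    ring

lemma sq_le_of_row {n : ℕ} {u : PhaseSpace n} {a R r : ℝ} (hu : 1 ≤ u ⬝ᵥ u)
    (h : ∀ z ∈ phaseBall n R, (u ⬝ᵥ z + a) ^ 2 ≤ r ^ 2) : R ^ 2 ≤ r ^ 2 := by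
  set q := u ⬝ᵥ u with hq
  have hs : 0 < Real.sqrt q := Real.sqrt_pos.2 (by linarith)
  have hss : Real.sqrt q ^ 2 = q := Real.sq_sqrt (by linarith)
  have key : ∀ e : ℝ, e ^ 2 = 1 → (e * R * Real.sqrt q + a) ^ 2 ≤ r ^ 2 := by
    intro e he
    have hm : (e * R / Real.sqrt q) • u ∈ phaseBall n R := by
      simp only [phaseBall, Set.mem_ofPred_eq, smul_dotProduct, dotProduct_smul,
        smul_eq_mul, ← hq]
      have : e * R / Real.sqrt q * (e * R / Real.sqrt q * q)
          = e ^ 2 * R ^ 2 * (q / Real.sqrt q ^ 2) := by field_simp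
      rw [this, hss, he, div_self (by linarith)]
      linarith
    have := h _ hm
    rw [dotProduct_smul, smul_eq_mul, ← hq] at this
    have h3 : e * R / Real.sqrt q * q = e * R * Real.sqrt q := by
      rw [div_mul_eq_mul_div, div_eq_iff hs.ne', mul_assoc, mul_assoc, mul_assoc, ← sq, hss]
    rwa [h3] at this
  have h1 := key 1 (by norm_num)
  have h2 := key (-1) (by norm_num)
  nlinarith [sq_nonneg a, sq_nonneg R]

lemma linearCapacity_cylinder_le {n : ℕ} (j : Fin n) {r : ℝ} :
    linearCapacity (phaseCylinder j r) ≤ ENNReal.ofReal (Real.pi * r ^ 2) := by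
  refine iSup₂_le fun R hR => ENNReal.ofReal_le_ofReal ?_
  obtain ⟨-, S, hS, v, hv⟩ := hR
  refine mul_le_mul_of_nonneg_left ?_ Real.pi_pos.le
  have hrow : ∀ i z, (S *ᵥ z + v) i = S i ⬝ᵥ z + v i := fun i z => rfl
  have hJ := congrFun (congrFun (SymplecticGroup.mem_iff.1 hS) (Sum.inl j)) (Sum.inr j)
  have hJ1 : S (Sum.inl j) ⬝ᵥ (Matrix.J (Fin n) ℝ *ᵥ S (Sum.inr j)) = -1 := by
    rw [Matrix.mul_assoc] at hJ
    have : (Matrix.J (Fin n) ℝ) (Sum.inl j) (Sum.inr j) = -1 := by simp [Matrix.J]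
    rw [this] at hJ
    exact hJ
  have hJn : ∀ w : PhaseSpace n, (Matrix.J (Fin n) ℝ *ᵥ w) ⬝ᵥ (Matrix.J (Fin n) ℝ *ᵥ w)
      = w ⬝ᵥ w := by
    intro w
    simp [Matrix.J, Matrix.fromBlocks_mulVec, dotProduct, Fintype.sum_sum_type, Matrix.neg_mulVec,
      add_comm]
  have hCS : (S (Sum.inl j) ⬝ᵥ (Matrix.J (Fin n) ℝ *ᵥ S (Sum.inr j))) ^ 2
      ≤ (S (Sum.inl j) ⬝ᵥ S (Sum.inl j)) * (S (Sum.inr j) ⬝ᵥ S (Sum.inr j)) := by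
    rw [← hJn (S (Sum.inr j))]
    have := Finset.sum_mul_sq_le_sq_mul_sq Finset.univ (S (Sum.inl j))
      (Matrix.J (Fin n) ℝ *ᵥ S (Sum.inr j))
    simpa only [dotProduct, ← sq] using this
  rw [hJ1] at hCS
  have hn1 : 0 ≤ S (Sum.inl j) ⬝ᵥ S (Sum.inl j) :=
    Finset.sum_nonneg fun i _ => mul_self_nonneg _
  have hn2 : 0 ≤ S (Sum.inr j) ⬝ᵥ S (Sum.inr j) :=
    Finset.sum_nonneg fun i _ => mul_self_nonneg _
  by_cases h1 : 1 ≤ S (Sum.inl j) ⬝ᵥ S (Sum.inl j)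
  · refine sq_le_of_row (a := v (Sum.inl j)) h1 fun z hz => ?_
    have := hv z hz
    simp only [phaseCylinder, Set.mem_ofPred_eq, hrow] at this
    nlinarith [sq_nonneg (S (Sum.inr j) ⬝ᵥ z + v (Sum.inr j))]
  · have h2 : 1 ≤ S (Sum.inr j) ⬝ᵥ S (Sum.inr j) := by
      by_contra h2
      push Not at h1 h2
      nlinarith
    refine sq_le_of_row (a := v (Sum.inr j)) h2 fun z hz => ?_
    have := hv z hz
    simp only [phaseCylinder, Set.mem_ofPred_eq, hrow] at this
    nlinarith [sq_nonneg (S (Sum.inl j) ⬝ᵥ z + v (Sum.inl j))]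

lemma le_linearCapacity_ball (n : ℕ) {r : ℝ} (hr : 0 ≤ r) :
    ENNReal.ofReal (Real.pi * r ^ 2) ≤ linearCapacity (phaseBall n r) :=
  le_iSup₂_of_le r ⟨hr, 1, one_mem _, 0, fun z hz => by simpa using hz⟩ le_rfl

lemma phaseBall_subset_cylinder {n : ℕ} (j : Fin n) (r : ℝ) :
    phaseBall n r ⊆ phaseCylinder j r := by
  intro z hz
  simp only [phaseBall, phaseCylinder, Set.mem_ofPred_eq, dotProduct, Fintype.sum_sum_type,
    ← sq] at hz ⊢
  have h1 := Finset.single_le_sum (f := fun i => z (Sum.inl i) ^ 2)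
    (fun i _ => sq_nonneg _) (Finset.mem_univ j)
  have h2 := Finset.single_le_sum (f := fun i => z (Sum.inr i) ^ 2)
    (fun i _ => sq_nonneg _) (Finset.mem_univ j)
  linarith

/-- `c_lin` is a linear symplectic capacity, so there are such capacities. -/
theorem isLinearSymplecticCapacity_linearCapacity {n : ℕ} (hn : 0 < n) :
    IsLinearSymplecticCapacity (linearCapacity (n := n)) where
  image_eq S hS Ω := by
    refine le_antisymm ?_ (linearCapacity_image_le hS Ω)
    let T : Matrix.symplecticGroup (Fin n) ℝ := ⟨S, hS⟩
    have hT : ((T⁻¹ : Matrix.symplecticGroup (Fin n) ℝ) : Matrix _ _ ℝ) * S = 1 :=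
      congrArg Subtype.val (inv_mul_cancel T)
    refine (linearCapacity_image_le (T⁻¹).2 _).trans (le_of_eq ?_)
    rw [Set.image_image]
    simp [Matrix.mulVec_mulVec, hT]
  mono _ _ h := linearCapacity_mono h
  smul_eq t Ω := by
    rcases eq_or_ne t 0 with rfl | ht
    · have h0 : (0 : ℝ) • Ω ⊆ phaseCylinder (⟨0, hn⟩ : Fin n) 0 := by
        rintro _ ⟨z, -, rfl⟩
        simp [phaseCylinder]
      have := (linearCapacity_mono h0).trans (linearCapacity_cylinder_le _)
      simpa using this
    · refine le_antisymm ?_ (linearCapacity_smul_le ht Ω)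
      have h := linearCapacity_smul_le (inv_ne_zero ht) (t • Ω)
      rw [inv_smul_smul₀ ht] at h
      calc linearCapacity (t • Ω)
          = ENNReal.ofReal (t ^ 2) * (ENNReal.ofReal (t⁻¹ ^ 2) * linearCapacity (t • Ω)) := by
            rw [← mul_assoc, ← ENNReal.ofReal_mul (by positivity), ← mul_pow,
              mul_inv_cancel₀ ht]
            simp
        _ ≤ _ := by gcongr
  ball_eq r hr := le_antisymm
    ((linearCapacity_mono (phaseBall_subset_cylinder ⟨0, hn⟩ r)).trans
      (linearCapacity_cylinder_le _)) (le_linearCapacity_ball n hr)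
  cylinder_eq j r hr := le_antisymm (linearCapacity_cylinder_le j)
    ((le_linearCapacity_ball n hr).trans (linearCapacity_mono (phaseBall_subset_cylinder j r)))

/-- The Hilbert space `L²(ℝⁿ)` of complex-valued functions. -/
abbrev L2Space (n : ℕ) : Type := Lp ℂ 2 (volume : Measure (Fin n → ℝ))

/-- Density operators (quantum states): positive operators of trace class with trace `1`. For a
positive operator, to be of trace class with trace `1` means that its diagonal matrix elements in
every orthonormal basis form a summable family with sum `1`. -/
def IsDensityOperator {H : Type} [NormedAddCommGroup H] [InnerProductSpace ℂ H]
    (T : H →L[ℂ] H) : Prop :=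
  T.IsPositive ∧
    ∀ (ι : Type) (b : HilbertBasis ι ℂ H), HasSum (fun i => inner ℂ (b i) (T (b i))) 1

/-- The function `ρ ∈ L¹(ℝ²ⁿ)` is the Wigner distribution of the operator `T` on `L²(ℝⁿ)`: for all
`ψ`, `T ψ (x) = ∫∫ e^{(i/ħ) p · (x - y)} ρ((x + y)/2, p) ψ(y) dy dp` for almost all `x`.
For integrable `ρ` the double integral converges absolutely for almost all `x`. -/
def IsWignerDistribution {n : ℕ} (ħ : ℝ) (ρ : PhaseSpace n → ℝ) (T : L2Space n →L[ℂ] L2Space n) :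
    Prop :=
  ∀ ψ : L2Space n, ∀ᵐ x : Fin n → ℝ,
    T ψ x = ∫ w : (Fin n → ℝ) × (Fin n → ℝ),
      Complex.exp (Complex.I / ħ * ((w.2 ⬝ᵥ (x - w.1) : ℝ) : ℂ)) *
        (ρ (phasePoint ((1 / 2 : ℝ) • (x + w.1)) w.2) : ℂ) * ψ w.1

/-!
The upper bound on `ρ` is one-sided, so it is used only against positive functions: the Wigner
functions of Gaussian wave packets `g`, for which `⟨g, T g⟩` is the integral of `ρ` against a
Gaussian (`IsWignerDistribution.exists_inner_gaussianPacket_eq`).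

A weak form of Williamson's theorem (`exists_triangularMatrix_mem_symplecticGroup`) gives a
symplectic block triangular `S` for which `K = Sᵀ M S` commutes with `J`. If all eigenvalues of
`K` were at most `1`, the image under `S` of the ball of radius `√ħ` would lie in the ellipsoid,
whose capacity would be at least `π ħ`. So `K v = μ v` for a unit vector `v` and some `μ > 1`, and
then `K J v = μ J v` (`exists_eigenvector_of_capacity_lt`). As `S` is triangular, its metaplectic
operator is a rescaling times a chirp; it is built into the wave packets, and no metaplectic
representation is needed.

The packets `g_a` are holomorphic in `a ∈ ℂⁿ`, and the centre of `g_a` in the coordinates given by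
`S` is `(Re a, Im a)`. By the Cauchy–Schwarz inequality for the positive operator `T`,
`|⟨T ψ, g_a⟩|² ≤ ⟨ψ, T ψ⟩ ⟨g_a, T g_a⟩`. Along a complex line whose real directions are `v` and `J v`,
completing squares in the Gaussian majorant shows that `⟨g_a, T g_a⟩` is at most a constant times
`exp (-δ |ζ|² / ħ)` with `δ = (μ - 1) / (2 (1 + μ)) > 0` (`exists_sq_add_le_quadForm_add_sq`).
Therefore the entire function `ζ ↦ ⟨T ψ, g_a⟩` vanishes by Liouville's theorem, and
`⟨g_a, T g_a⟩ = 0` for all `a` (`IsWignerDistribution.inner_gaussianPacket_eq_zero`). This says that the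
convolution of `ρ ∘ S` with a Gaussian is zero, so the integral of `ρ` is zero and not one.
-/

/-! ### Symplectic normal form and capacity -/

open scoped MatrixOrder in
lemma Matrix.PosDef.exists_sqrt {m : Type*} [Fintype m] [DecidableEq m] {B : Matrix m m ℝ}
    (hB : B.PosDef) :
    ∃ D : Matrix m m ℝ, D.PosDef ∧ D * D = B ∧ ∀ N, Commute B N → Commute D N := by
  refine ⟨CFC.sqrt B, Matrix.isStrictlyPositive_iff_posDef.1 hB.isStrictlyPositive.sqrt,
    CFC.sqrt_mul_sqrt_self B hB.posSemidef.nonneg, fun N hN => ?_⟩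
  rw [CFC.sqrt_eq_cfc]
  exact hN.cfc_nnreal _

/-- Every positive definite `M` has a compatible positive definite symplectic matrix `G`
(`G J G = J`): the complex structure `J G` commutes with `G⁻¹ M`, which is the second equation. With
`R = M^{1/2}` and the antisymmetric matrix `N = R J R` one takes `G = R |N|⁻¹ R`. -/
lemma exists_posDef_compatible {l : Type*} [Fintype l] [DecidableEq l]
    {M : Matrix (l ⊕ l) (l ⊕ l) ℝ} (hM : M.PosDef) :
    ∃ G : Matrix (l ⊕ l) (l ⊕ l) ℝ, G.PosDef ∧ G * Matrix.J l ℝ * G = Matrix.J l ℝ ∧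
      M * Matrix.J l ℝ * G = G * Matrix.J l ℝ * M := by
  obtain ⟨R, hR, hRM, -⟩ := hM.exists_sqrt
  set J := Matrix.J l ℝ with hJ
  have hJJ : J * J = -1 := Matrix.J_squared l ℝ
  have hJT : Jᵀ = -J := Matrix.J_transpose l ℝ
  have hRT : Rᵀ = R := by simpa using hR.isHermitian.eq
  have hRu : IsUnit R := hR.isUnit
  have hJu : IsUnit J := (Matrix.isUnit_iff_isUnit_det J).2 (Matrix.isUnit_det_J l ℝ)
  set N := R * J * R with hN
  have hNu : IsUnit N := (hRu.mul hJu).mul hRu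
  have hNT : Nᵀ = -N := by simp [hN, Matrix.transpose_mul, hRT, hJT, Matrix.mul_assoc]
  have hB : (Nᵀ * N).PosDef := by
    have := Matrix.PosDef.conjTranspose_mul_self N (Matrix.mulVec_injective_of_isUnit hNu)
    simpa using this
  -- `D = |N|⁻¹` commutes with `N`.
  obtain ⟨D, hD, hDD, hDc⟩ := hB.inv.exists_sqrt
  have hBu : IsUnit (Nᵀ * N).det := (Matrix.isUnit_iff_isUnit_det _).1 hB.isUnit
  have hDN : D * N = N * D := by
    refine hDc N ?_
    have h : (Nᵀ * N) * N = N * (Nᵀ * N) := by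
      rw [hNT]; noncomm_ring
    show (Nᵀ * N)⁻¹ * N = N * (Nᵀ * N)⁻¹
    calc (Nᵀ * N)⁻¹ * N = (Nᵀ * N)⁻¹ * (N * (Nᵀ * N)) * (Nᵀ * N)⁻¹ := by
          rw [Matrix.mul_assoc, Matrix.mul_assoc N, Matrix.mul_nonsing_inv _ hBu, Matrix.mul_one]
      _ = N * (Nᵀ * N)⁻¹ := by
          rw [← h, ← Matrix.mul_assoc, Matrix.nonsing_inv_mul _ hBu, Matrix.one_mul]
  have hDNDN : D * N * D * N = -1 := by
    calc D * N * D * N = D * (N * D) * N := by noncomm_ring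
      _ = D * D * (N * N) := by rw [← hDN]; noncomm_ring
      _ = -((Nᵀ * N)⁻¹ * (Nᵀ * N)) := by rw [hDD, hNT]; simp
      _ = -1 := by rw [Matrix.nonsing_inv_mul _ hBu]
  refine ⟨R * D * R, ?_, ?_, ?_⟩
  · have := hD.conjTranspose_mul_mul_same (Matrix.mulVec_injective_of_isUnit hRu)
    simpa [hRT] using this
  · apply hJu.mul_right_cancel
    apply hRu.mul_right_cancel
    calc R * D * R * J * (R * D * R) * J * R = R * (D * (R * J * R) * D * (R * J * R)) := by
          noncomm_ring
      _ = J * J * R := by rw [← hN, hDNDN, hJJ]; simp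
  · calc M * J * (R * D * R) = R * (N * D) * R := by rw [← hRM, hN]; noncomm_ring
      _ = R * D * R * J * M := by rw [← hDN, ← hRM, hN]; noncomm_ring

/-- The block triangular matrix with rows `(L, 0)` and `(-Y L, L⁻¹)`, symplectic for symmetric
`Y` and invertible symmetric `L`. On wave functions it acts as the rescaling `ψ ↦ ψ ∘ L⁻¹` followed by multiplication with
the chirp `exp (-(i/2ħ) Y x · x)`. -/
noncomputable def triangularMatrix {l : Type*} [Fintype l] [DecidableEq l] (L Y : Matrix l l ℝ) :
    Matrix (l ⊕ l) (l ⊕ l) ℝ :=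
  Matrix.fromBlocks L 0 (-(Y * L)) L⁻¹

/-- A weak form of Williamson's theorem: a triangular symplectic `S` makes `Sᵀ M S` commute with
`J`. Here `S` is the block Cholesky factor of the inverse of a compatible `G`, so that
`Sᵀ G S = 1`. -/
lemma exists_triangularMatrix_mem_symplecticGroup {l : Type*} [Fintype l] [DecidableEq l]
    {M : Matrix (l ⊕ l) (l ⊕ l) ℝ} (hM : M.PosDef) :
    ∃ L Y : Matrix l l ℝ, L.PosDef ∧ Yᵀ = Y ∧
      triangularMatrix L Y ∈ Matrix.symplecticGroup l ℝ ∧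
      Commute ((triangularMatrix L Y)ᵀ * M * triangularMatrix L Y) (Matrix.J l ℝ) := by
  obtain ⟨G, hG, hGJ, hMG⟩ := exists_posDef_compatible hM
  obtain ⟨A, B, B', P, rfl⟩ : ∃ A B B' P, G = Matrix.fromBlocks A B B' P :=
    ⟨_, _, _, _, (Matrix.fromBlocks_toBlocks G).symm⟩
  have hGT := hG.isHermitian.eq
  simp only [Matrix.conjTranspose_eq_transpose_of_trivial, Matrix.fromBlocks_transpose,
    Matrix.fromBlocks_inj] at hGT
  obtain ⟨hAT, hBT', hBT, hPT⟩ := hGT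
  subst hBT
  have hP : P.PosDef := by
    exact hG.submatrix (Sum.inr_injective (α := l) (β := l))
  obtain ⟨L, hL, hLP, -⟩ := hP.exists_sqrt
  have hLT : Lᵀ = L := by simpa using hL.isHermitian.eq
  have hLu : IsUnit L.det := (Matrix.isUnit_iff_isUnit_det _).1 hL.isUnit
  have hPu : IsUnit P.det := (Matrix.isUnit_iff_isUnit_det _).1 hP.isUnit
  have hJ := hGJ
  simp only [Matrix.J, Matrix.fromBlocks_multiply, Matrix.fromBlocks_inj] at hJ
  simp only [Matrix.mul_zero, Matrix.mul_one, Matrix.mul_neg, zero_add, add_zero,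
    Matrix.neg_mul] at hJ
  obtain ⟨h11, h12, h21, h22⟩ := hJ
  have hPi : P⁻¹ = L⁻¹ * L⁻¹ := by rw [← hLP, Matrix.mul_inv_rev]
  have hPPi : P * P⁻¹ = 1 := Matrix.mul_nonsing_inv _ hPu
  have hPiP : P⁻¹ * P = 1 := Matrix.nonsing_inv_mul _ hPu
  have hLLi : L * L⁻¹ = 1 := Matrix.mul_nonsing_inv _ hLu
  have hLiL : L⁻¹ * L = 1 := Matrix.nonsing_inv_mul _ hLu
  have hLiT : (L⁻¹)ᵀ = L⁻¹ := by rw [Matrix.transpose_nonsing_inv, hLT]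
  have hPB : P * B = Bᵀ * P := by
    rwa [← sub_eq_add_neg, sub_eq_zero] at h22
  set Y := P⁻¹ * Bᵀ with hY
  have hYP : Y * P = B := by
    rw [hY, Matrix.mul_assoc, ← hPB, ← Matrix.mul_assoc, hPiP, Matrix.one_mul]
  have hYT : Yᵀ = Y := by
    have : (P⁻¹)ᵀ = P⁻¹ := by rw [Matrix.transpose_nonsing_inv, hPT]
    calc Yᵀ = B * P⁻¹ := by rw [hY, Matrix.transpose_mul, Matrix.transpose_transpose, this]
      _ = Y * (P * P⁻¹) := by rw [← Matrix.mul_assoc, hYP]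
      _ = Y := by rw [hPPi, Matrix.mul_one]
  have hPY : P * Y = Bᵀ := by rw [hY, ← Matrix.mul_assoc, hPPi, Matrix.one_mul]
  have hABY : A - B * Y = P⁻¹ := by
    have : (A - B * Y) * P = 1 := by
      rw [Matrix.sub_mul, Matrix.mul_assoc, hYP]
      rw [← neg_eq_iff_eq_neg] at h12
      rw [← h12]
      abel
    calc A - B * Y = (A - B * Y) * P * P⁻¹ := by rw [Matrix.mul_assoc, hPPi, Matrix.mul_one]
      _ = P⁻¹ := by rw [this, Matrix.one_mul]
  have hS : triangularMatrix L Y ∈ Matrix.symplecticGroup l ℝ := by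
    rw [triangularMatrix, SymplecticGroup.fromBlocks_mem_iff]
    simp [Matrix.transpose_mul, hLT, hYT, hLLi, Matrix.mul_assoc]
  have hSG : (triangularMatrix L Y)ᵀ * Matrix.fromBlocks A B Bᵀ P * triangularMatrix L Y = 1 := by
    have h : Matrix.fromBlocks A B Bᵀ P * triangularMatrix L Y =
        Matrix.fromBlocks L⁻¹ (Y * L) 0 L := by
      rw [triangularMatrix, Matrix.fromBlocks_multiply, Matrix.fromBlocks_inj]
      refine ⟨?_, ?_, ?_, ?_⟩
      · rw [Matrix.mul_neg, ← sub_eq_add_neg, ← Matrix.mul_assoc, ← Matrix.sub_mul, hABY, hPi,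
          Matrix.mul_assoc, hLiL, Matrix.mul_one]
      · rw [Matrix.mul_zero, zero_add, ← hYP, ← hLP]
        simp only [Matrix.mul_assoc, hLLi, Matrix.mul_one]
      · rw [Matrix.mul_neg, ← Matrix.mul_assoc, hPY, add_neg_cancel]
      · rw [Matrix.mul_zero, zero_add, ← hLP, Matrix.mul_assoc, hLLi, Matrix.mul_one]
    rw [Matrix.mul_assoc, h, triangularMatrix, Matrix.fromBlocks_transpose,
      Matrix.fromBlocks_multiply, ← Matrix.fromBlocks_one, Matrix.fromBlocks_inj]
    simp [Matrix.transpose_mul, hLT, hYT, hLLi, hLiL, hLiT, Matrix.mul_assoc]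
  refine ⟨L, Y, hL, hYT, hS, ?_⟩
  set S := triangularMatrix L Y
  set G := Matrix.fromBlocks A B Bᵀ P
  have hSJ : S * Matrix.J l ℝ * Sᵀ = Matrix.J l ℝ := SymplecticGroup.mem_iff.1 hS
  have h1 : S * Matrix.J l ℝ = Matrix.J l ℝ * G * S := by
    calc S * Matrix.J l ℝ = S * Matrix.J l ℝ * (Sᵀ * G * S) := by rw [hSG, Matrix.mul_one]
      _ = S * Matrix.J l ℝ * Sᵀ * G * S := by noncomm_ring
      _ = _ := by rw [hSJ]
  have h2 : Matrix.J l ℝ * Sᵀ = Sᵀ * G * Matrix.J l ℝ := by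
    calc Matrix.J l ℝ * Sᵀ = Sᵀ * G * S * Matrix.J l ℝ * Sᵀ := by rw [hSG, Matrix.one_mul]
      _ = Sᵀ * G * (S * Matrix.J l ℝ * Sᵀ) := by noncomm_ring
      _ = _ := by rw [hSJ]
  calc Sᵀ * M * S * Matrix.J l ℝ = Sᵀ * M * (S * Matrix.J l ℝ) := by noncomm_ring
    _ = Sᵀ * (M * Matrix.J l ℝ * G) * S := by rw [h1]; noncomm_ring
    _ = Sᵀ * G * Matrix.J l ℝ * M * S := by rw [hMG]; noncomm_ring
    _ = Matrix.J l ℝ * (Sᵀ * M * S) := by rw [← h2]; noncomm_ring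

lemma quadForm_mulVec {n : ℕ} (M S : Matrix (Fin n ⊕ Fin n) (Fin n ⊕ Fin n) ℝ)
    (z : PhaseSpace n) : quadForm M (S *ᵥ z) = ((Sᵀ * M * S) *ᵥ z) ⬝ᵥ z := by
  rw [quadForm, ← Matrix.mulVec_mulVec, ← Matrix.mulVec_mulVec, Matrix.mulVec_transpose,
    Matrix.dotProduct_mulVec]

/-- If the ellipsoid of `M` has capacity less than that of the ball of radius `√ħ`, then `Sᵀ M S`
has an eigenvalue above `1`: otherwise the symplectic map `S` sends this ball into the
ellipsoid. -/
lemma exists_eigenvector_of_capacity_lt {n : ℕ} {ħ : ℝ} (hħ : 0 < ħ)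
    {c : Set (PhaseSpace n) → ℝ≥0∞} (hc : IsLinearSymplecticCapacity c)
    {M S : Matrix (Fin n ⊕ Fin n) (Fin n ⊕ Fin n) ℝ} (hM : M.PosDef)
    (hS : S ∈ Matrix.symplecticGroup (Fin n) ℝ)
    (hcap : c (phaseEllipsoid ħ M) < ENNReal.ofReal (Real.pi * ħ)) :
    ∃ (μ : ℝ) (v : PhaseSpace n), 1 < μ ∧ v ⬝ᵥ v = 1 ∧ (Sᵀ * M * S) *ᵥ v = μ • v := by
  set K := Sᵀ * M * S with hK
  have hKh : K.IsHermitian := by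
    have := Matrix.isHermitian_conjTranspose_mul_mul S hM.isHermitian
    simpa using this
  by_contra! hcon
  have hev : ∀ i, hKh.eigenvalues i ≤ 1 := by
    intro i
    by_contra! hi
    refine hcon _ (hKh.eigenvectorBasis i) hi ?_ ?_
    · have := hKh.eigenvectorBasis.norm_eq_one i
      have h2 : ‖hKh.eigenvectorBasis i‖ ^ 2 = 1 := by rw [this]; norm_num
      rw [EuclideanSpace.real_norm_sq_eq] at h2
      simpa [dotProduct, ← sq] using h2
    · exact hKh.mulVec_eigenvectorBasis i
  have hle : ∀ z : PhaseSpace n, (K *ᵥ z) ⬝ᵥ z ≤ z ⬝ᵥ z := by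
    intro z
    obtain ⟨U, d, hd, hU, hUK⟩ : ∃ (U : Matrix (Fin n ⊕ Fin n) (Fin n ⊕ Fin n) ℝ)
        (d : Fin n ⊕ Fin n → ℝ), (∀ i, d i ≤ 1) ∧ U * Uᵀ = 1 ∧
        K = U * Matrix.diagonal d * Uᵀ := by
      refine ⟨hKh.eigenvectorUnitary, hKh.eigenvalues, hev, ?_, ?_⟩
      · exact Unitary.mul_star_self_of_mem hKh.eigenvectorUnitary.2
      · conv_lhs => rw [hKh.spectral_theorem, Unitary.conjStarAlgAut_apply]
        rfl
    have h1 : (K *ᵥ z) ⬝ᵥ z = (Matrix.diagonal d *ᵥ (Uᵀ *ᵥ z)) ⬝ᵥ (Uᵀ *ᵥ z) := by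
      rw [hUK, ← Matrix.mulVec_mulVec, ← Matrix.mulVec_mulVec, Matrix.mulVec_transpose U z,
        dotProduct_comm _ (z ᵥ* U), ← Matrix.dotProduct_mulVec, dotProduct_comm]
    have h2 : z ⬝ᵥ z = (Uᵀ *ᵥ z) ⬝ᵥ (Uᵀ *ᵥ z) := by
      rw [Matrix.dotProduct_mulVec, Matrix.vecMul_transpose, Matrix.mulVec_mulVec, hU,
        Matrix.one_mulVec]
    rw [h1, h2]
    refine Finset.sum_le_sum fun i _ => ?_
    rw [Matrix.mulVec_diagonal]
    nlinarith [hd i, mul_self_nonneg ((Uᵀ *ᵥ z) i)]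
  have hsub : (fun z => S *ᵥ z) '' phaseBall n (√ħ) ⊆ phaseEllipsoid ħ M := by
    rintro _ ⟨z, hz, rfl⟩
    have h2 : z ⬝ᵥ z ≤ √ħ ^ 2 := hz
    rw [Real.sq_sqrt hħ.le] at h2
    show quadForm M (S *ᵥ z) ≤ ħ
    rw [quadForm_mulVec]
    exact (hle z).trans h2
  have := hc.mono _ _ hsub
  rw [hc.image_eq S hS, hc.ball_eq _ (Real.sqrt_nonneg _), Real.sq_sqrt hħ.le] at this
  exact absurd hcap (not_lt.2 this)

/-! ### Positive operators, entire functions and Gaussian estimates -/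

/-- The **Cauchy–Schwarz inequality** for the semidefinite form `⟨T x, y⟩`. -/
lemma ContinuousLinearMap.IsPositive.norm_inner_sq_le {H : Type*} [NormedAddCommGroup H]
    [InnerProductSpace ℂ H] {T : H →L[ℂ] H} (hT : T.IsPositive) (x y : H) :
    ‖inner ℂ (T x) y‖ ^ 2 ≤ (inner ℂ x (T x)).re * (inner ℂ y (T y)).re := by
  let core : PreInnerProductSpace.Core ℂ H :=
    { inner := fun x y => inner ℂ (T x) y
      conj_inner_symm := fun x y => by
        rw [inner_conj_symm, hT.inner_left_eq_inner_right]
      re_inner_nonneg := hT.re_inner_nonneg_left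
      add_left := fun x y z => by rw [map_add, inner_add_left]
      smul_left := fun x y r => by rw [map_smul, inner_smul_left] }
  have h := @InnerProductSpace.Core.inner_mul_inner_self_le ℂ H _ _ _ core x y
  have h2 : ‖inner ℂ (T y) x‖ = ‖inner ℂ (T x) y‖ := by
    rw [← inner_conj_symm, RCLike.norm_conj, hT.inner_left_eq_inner_right]
  change ‖inner ℂ (T x) y‖ * ‖inner ℂ (T y) x‖ ≤
    (inner ℂ (T x) x).re * (inner ℂ (T y) y).re at h
  rwa [h2, ← sq, hT.inner_left_eq_inner_right x x, hT.inner_left_eq_inner_right y y] at h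

/-- An entire function with Gaussian decay vanishes, by Liouville's theorem. -/
lemma Differentiable.eq_zero_of_gaussian_decay {F : ℂ → ℂ} (hF : Differentiable ℂ F) {A κ : ℝ}
    (hκ : 0 < κ) (h : ∀ ζ, ‖F ζ‖ ^ 2 ≤ A * Real.exp (-κ * ‖ζ‖ ^ 2)) (ζ : ℂ) : F ζ = 0 := by
  refine hF.apply_eq_of_tendsto_cocompact ζ ?_
  have h1 : Filter.Tendsto (fun ζ : ℂ => A * Real.exp (-κ * ‖ζ‖ ^ 2)) (Filter.cocompact ℂ)
      (nhds 0) := by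
    have h2 : Filter.Tendsto (fun ζ : ℂ => κ * ‖ζ‖ ^ 2) (Filter.cocompact ℂ) Filter.atTop :=
      ((Filter.tendsto_pow_atTop two_ne_zero).comp
        tendsto_norm_cocompact_atTop).const_mul_atTop hκ
    have := (Real.tendsto_exp_neg_atTop_nhds_zero.comp h2).const_mul A
    simpa [Function.comp_def] using this
  have h3 : Filter.Tendsto (fun ζ : ℂ => ‖F ζ‖ ^ 2) (Filter.cocompact ℂ) (nhds 0) :=
    squeeze_zero (fun _ => by positivity) h h1
  have h4 := h3.sqrt
  simp only [Real.sqrt_sq (norm_nonneg _), Real.sqrt_zero] at h4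
  exact tendsto_zero_iff_norm_tendsto_zero.2 h4

lemma differentiable_integral_mul_cexp {X : Type*} [MeasurableSpace X] {μ : Measure X}
    {φ w : X → ℂ} (hφ : AEStronglyMeasurable φ μ) (hw : AEStronglyMeasurable w μ)
    (h : ∀ r : ℝ, Integrable (fun x => ‖φ x‖ * Real.exp (r * ‖w x‖)) μ) :
    Differentiable ℂ (fun ζ : ℂ => ∫ x, φ x * Complex.exp (ζ * w x) ∂μ) := by
  intro ζ₀
  have hm : ∀ ζ : ℂ, AEStronglyMeasurable (fun x => φ x * Complex.exp (ζ * w x)) μ := fun ζ =>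
    hφ.mul (Complex.continuous_exp.comp_aestronglyMeasurable (hw.const_mul ζ))
  have hexp : ∀ (ζ : ℂ) (r : ℝ) (x : X), ‖ζ‖ ≤ r →
      ‖Complex.exp (ζ * w x)‖ ≤ Real.exp (r * ‖w x‖) := by
    intro ζ r x hr
    refine (Complex.norm_exp_le_exp_norm _).trans (Real.exp_le_exp.2 ?_)
    rw [norm_mul]
    gcongr
  have := hasDerivAt_integral_of_dominated_loc_of_deriv_le (μ := μ) (𝕜 := ℂ)
    (F := fun ζ x => φ x * Complex.exp (ζ * w x))
    (F' := fun ζ x => φ x * Complex.exp (ζ * w x) * w x) (x₀ := ζ₀)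
    (bound := fun x => ‖φ x‖ * Real.exp ((‖ζ₀‖ + 2) * ‖w x‖))
    (Metric.ball_mem_nhds ζ₀ one_pos) (Filter.Eventually.of_forall hm) ?_ ((hm ζ₀).mul hw) ?_
    (h _) ?_
  · exact this.2.differentiableAt
  · refine (h ‖ζ₀‖).mono' (hm ζ₀) (Filter.Eventually.of_forall fun x => ?_)
    rw [norm_mul]
    gcongr
    exact hexp _ _ _ le_rfl
  · refine Filter.Eventually.of_forall fun x ζ hζ => ?_
    have hζ' : ‖ζ‖ ≤ ‖ζ₀‖ + 1 := by
      have h1 : ‖ζ - ζ₀‖ < 1 := by simpa [dist_eq_norm] using hζ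
      have h2 := norm_add_le (ζ - ζ₀) ζ₀
      rw [sub_add_cancel] at h2
      linarith
    have hw' : ‖w x‖ ≤ Real.exp ‖w x‖ := by linarith [Real.add_one_le_exp ‖w x‖]
    rw [norm_mul, norm_mul, mul_assoc]
    gcongr
    calc ‖Complex.exp (ζ * w x)‖ * ‖w x‖ ≤ Real.exp ((‖ζ₀‖ + 1) * ‖w x‖) * Real.exp ‖w x‖ := by
          gcongr
          exact hexp _ _ _ hζ'
      _ = Real.exp ((‖ζ₀‖ + 2) * ‖w x‖) := by rw [← Real.exp_add]; ring_nf
  · refine Filter.Eventually.of_forall fun x ζ _ => ?_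
    have := (((hasDerivAt_id ζ).mul_const (w x)).cexp).const_mul (φ x)
    simpa [mul_assoc] using this

section LinearChangeOfVariables

variable {E F : Type*} [NormedAddCommGroup E] [NormedSpace ℝ E]
  [MeasurableSpace E] [BorelSpace E]
  [NormedAddCommGroup F] [NormedSpace ℝ F]
  [FiniteDimensional ℝ F] [MeasurableSpace F] [BorelSpace F] (e : E ≃L[ℝ] F)
  (μ : Measure E) [μ.IsAddHaarMeasure] (ν : Measure F) [ν.IsAddHaarMeasure]

lemma ContinuousLinearEquiv.exists_smul_map_addHaar_eq :
    ∃ k : NNReal, 0 < k ∧ ν = (k : ℝ≥0∞) • μ.map e :=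
  ⟨_, Measure.addHaarScalarFactor_pos_of_isAddHaarMeasure ν (μ.map e),
    Measure.isAddLeftInvariant_eq_smul ν (μ.map e)⟩

lemma ContinuousLinearEquiv.exists_integral_eq_smul_integral_comp (V : Type*)
    [NormedAddCommGroup V] [NormedSpace ℝ V] :
    ∃ k : ℝ, 0 < k ∧ ∀ f : F → V, ∫ y, f y ∂ν = k • ∫ x, f (e x) ∂μ := by
  obtain ⟨k, hk, h⟩ := e.exists_smul_map_addHaar_eq μ ν
  have hemb : MeasurableEmbedding e := e.toHomeomorph.measurableEmbedding
  refine ⟨k, hk, fun f => ?_⟩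
  rw [h, integral_smul_measure, hemb.integral_map]
  rfl

lemma ContinuousLinearEquiv.integrable_comp_addHaar_iff {V : Type*} [NormedAddCommGroup V]
    (f : F → V) : Integrable (fun x => f (e x)) μ ↔ Integrable f ν := by
  obtain ⟨k, hk, h⟩ := e.exists_smul_map_addHaar_eq μ ν
  have hemb : MeasurableEmbedding e := e.toHomeomorph.measurableEmbedding
  rw [h, integrable_smul_measure (by simpa using hk.ne') ENNReal.coe_ne_top,
    hemb.integrable_map_iff]
  rfl

end LinearChangeOfVariables

/-- Multiplication by an invertible matrix as a continuous linear equivalence. -/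
noncomputable def Matrix.mulVecCLE {m : Type*} [Fintype m] [DecidableEq m] (A : Matrix m m ℝ)
    (hA : IsUnit A.det) : (m → ℝ) ≃L[ℝ] (m → ℝ) :=
  (Matrix.toLin'OfInv (Matrix.nonsing_inv_mul A hA)
    (Matrix.mul_nonsing_inv A hA)).toContinuousLinearEquiv

lemma Matrix.mulVecCLE_apply {m : Type*} [Fintype m] [DecidableEq m] (A : Matrix m m ℝ)
    (hA : IsUnit A.det) (x : m → ℝ) : A.mulVecCLE hA x = A *ᵥ x := rfl

/-- Let `K` be `μ > 1` times the identity on the plane spanned by the orthonormal `v`, `v'`, let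
`u` be orthogonal to this plane and `w = u + s v + t v'`. Then `K z · z + |z - w|²` exceeds a
translate of `|z|²` by at least `(|w|² - |u|²) / 2`, with a gain proportional to `s² + t²`. The
minimum of `μ |y|² + |y - w|²` over the plane is `μ / (1 + μ)` times `s² + t²`, and `μ > 1` makes
this factor larger than `1 / 2`. -/
lemma exists_sq_add_le_quadForm_add_sq {m : Type*} [Fintype m] {K : Matrix m m ℝ} (hK : K.PosDef)
    {μ : ℝ} (hμ : 1 < μ) {v v' : m → ℝ} (hv : K *ᵥ v = μ • v) (hv' : K *ᵥ v' = μ • v')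
    (hvv : v ⬝ᵥ v = 1) (hvv' : v' ⬝ᵥ v' = 1) (h0 : v ⬝ᵥ v' = 0)
    {u : m → ℝ} (hu : u ⬝ᵥ v = 0) (hu' : u ⬝ᵥ v' = 0) (s t : ℝ) :
    ∃ z₀ : m → ℝ, ∀ z : m → ℝ, (z - z₀) ⬝ᵥ (z - z₀) +
        ((u + s • v + t • v') ⬝ᵥ (u + s • v + t • v') - u ⬝ᵥ u) / 2 +
        (μ - 1) / (2 * (1 + μ)) * (s ^ 2 + t ^ 2) ≤
      (K *ᵥ z) ⬝ᵥ z + (z - (u + s • v + t • v')) ⬝ᵥ (z - (u + s • v + t • v')) := by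
  have hKT : Kᵀ = K := by simpa using hK.isHermitian.eq
  refine ⟨u + (s / (1 + μ)) • v + (t / (1 + μ)) • v', fun z => ?_⟩
  have hKv : ∀ w, K *ᵥ w = μ • w → (K *ᵥ z) ⬝ᵥ w = μ * (z ⬝ᵥ w) := by
    intro w hw
    rw [← Matrix.vecMul_transpose, hKT, ← Matrix.dotProduct_mulVec, hw, dotProduct_smul,
      smul_eq_mul]
  set a := z ⬝ᵥ v with ha
  set b := z ⬝ᵥ v' with hb
  have hpos : 0 ≤ (K *ᵥ (z - a • v - b • v')) ⬝ᵥ (z - a • v - b • v') := by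
    have := hK.posSemidef.dotProduct_mulVec_nonneg (z - a • v - b • v')
    rwa [star_trivial, dotProduct_comm] at this
  have hlow : μ * (a ^ 2 + b ^ 2) ≤ (K *ᵥ z) ⬝ᵥ z := by
    have h0' : v' ⬝ᵥ v = 0 := by rw [dotProduct_comm, h0]
    simp only [Matrix.mulVec_sub, Matrix.mulVec_smul, hv, hv', sub_dotProduct, dotProduct_sub,
      smul_dotProduct, dotProduct_smul, smul_eq_mul, hKv v hv, hKv v' hv', dotProduct_comm v z,
      dotProduct_comm v' z, ← ha, ← hb, hvv, hvv', h0, h0'] at hpos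
    linarith
  refine le_trans ?_ (add_le_add_left hlow _)
  simp only [add_dotProduct, dotProduct_add, sub_dotProduct, dotProduct_sub, smul_dotProduct,
    dotProduct_smul, smul_eq_mul, hvv, hvv', h0, hu, hu', dotProduct_comm v z, dotProduct_comm v' z,
    dotProduct_comm v' v, dotProduct_comm v u, dotProduct_comm v' u, ← ha, ← hb]
  have h1 : 0 < 1 + μ := by linarith
  have h2 : 0 ≤ μ * ((a - s / (1 + μ)) ^ 2 + (b - t / (1 + μ)) ^ 2) := by positivity
  have h3 : s = (s / (1 + μ)) * (1 + μ) := by field_simp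
  have h4 : t = (t / (1 + μ)) * (1 + μ) := by field_simp
  have h5 : (μ - 1) / (2 * (1 + μ)) * (s ^ 2 + t ^ 2) =
    (μ - 1) * (1 + μ) / 2 * ((s / (1 + μ)) ^ 2 + (t / (1 + μ)) ^ 2) := by field_simp
  rw [h5]
  generalize s / (1 + μ) = s' at *
  generalize t / (1 + μ) = t' at *
  subst h3 h4
  nlinarith

/-! ### Gaussian wave packets -/

/-- The Gaussian wave packet
`exp (-(i/2ħ) Y x · x - |y|² / 2ħ + a · y / ħ - a · a / 4ħ)` with `y = L⁻¹ x`, for `a ∈ ℂⁿ`. It is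
holomorphic in `a`; the factor `exp (-a · a / 4ħ)` makes its norm depend on `|a|` only. -/
noncomputable def gaussianPacket {n : ℕ} (ħ : ℝ) (L Y : Matrix (Fin n) (Fin n) ℝ) (a : Fin n → ℂ)
    (x : Fin n → ℝ) : ℂ :=
  Complex.exp (-(Complex.I / (2 * ħ)) * (((Y *ᵥ x) ⬝ᵥ x : ℝ) : ℂ) +
    ∑ i, (-(1 / (2 * ħ)) * (((L⁻¹ *ᵥ x) i : ℝ) : ℂ) ^ 2 + 1 / ħ * (a i * ((L⁻¹ *ᵥ x) i : ℝ)) -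
      1 / (4 * ħ) * a i ^ 2))

/-- The centre `(Re a, Im a)` of a wave packet in the coordinates given by
`triangularMatrix L Y`. -/
def packetCenter {n : ℕ} (a : Fin n → ℂ) : PhaseSpace n :=
  phasePoint (fun i => (a i).re) (fun i => (a i).im)

lemma integrable_exp_neg_mul_sum_sq {m : Type*} [Fintype m] {b : ℝ} (hb : 0 < b) (c : m → ℝ) :
    Integrable (fun x : m → ℝ => Real.exp (-b * ∑ i, x i ^ 2 + ∑ i, c i * x i)) := by
  have := (GaussianFourier.integrable_cexp_neg_mul_sum_add (b := (b : ℂ)) (by simpa using hb)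
    (fun i => (c i : ℂ))).norm
  refine this.congr (Filter.Eventually.of_forall fun x => ?_)
  simp only [Complex.norm_exp]
  congr 1
  rw [← Complex.ofReal_re (-b * ∑ i, x i ^ 2 + ∑ i, c i * x i)]
  push_cast
  rfl

section Packet

variable {n : ℕ} {ħ : ℝ} {L Y : Matrix (Fin n) (Fin n) ℝ}

lemma continuous_gaussianPacket (a : Fin n → ℂ) : Continuous (gaussianPacket ħ L Y a) := by
  unfold gaussianPacket
  have h1 : ∀ A : Matrix (Fin n) (Fin n) ℝ, Continuous fun x : Fin n → ℝ => A *ᵥ x := fun A =>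
    continuous_const.matrix_mulVec continuous_id
  have h2 := h1 Y
  have h3 := h1 L⁻¹
  have h4 : Continuous fun x : Fin n → ℝ => (Y *ᵥ x) ⬝ᵥ x := h2.dotProduct continuous_id
  fun_prop

lemma norm_gaussianPacket (a : Fin n → ℂ) (x : Fin n → ℝ) :
    ‖gaussianPacket ħ L Y a x‖ = Real.exp (∑ i, (-(1 / (2 * ħ)) * (L⁻¹ *ᵥ x) i ^ 2 +
      1 / ħ * ((a i).re * (L⁻¹ *ᵥ x) i) - 1 / (4 * ħ) * ((a i).re ^ 2 - (a i).im ^ 2))) := by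
  rw [gaussianPacket, Complex.norm_exp]
  congr 1
  have h1 : (-(Complex.I / (2 * ħ)) * (((Y *ᵥ x) ⬝ᵥ x : ℝ) : ℂ)).re = 0 := by
    have : -(Complex.I / (2 * ħ)) * (((Y *ᵥ x) ⬝ᵥ x : ℝ) : ℂ) =
      ((-((Y *ᵥ x) ⬝ᵥ x) / (2 * ħ) : ℝ) : ℂ) * Complex.I := by push_cast; ring
    rw [this, Complex.re_ofReal_mul, Complex.I_re, mul_zero]
  rw [Complex.add_re, h1, zero_add, Complex.re_sum]
  refine Finset.sum_congr rfl fun i _ => ?_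
  have h2 : -(1 / (2 * ħ)) * (((L⁻¹ *ᵥ x) i : ℝ) : ℂ) ^ 2 + 1 / ħ * (a i * ((L⁻¹ *ᵥ x) i : ℝ)) -
      1 / (4 * ħ) * a i ^ 2 = ((-(1 / (2 * ħ)) * (L⁻¹ *ᵥ x) i ^ 2 : ℝ) : ℂ) +
      ((1 / ħ : ℝ) : ℂ) * (a i * ((L⁻¹ *ᵥ x) i : ℝ)) - ((1 / (4 * ħ) : ℝ) : ℂ) * a i ^ 2 := by
    push_cast; ring
  rw [h2, Complex.sub_re, Complex.add_re, Complex.ofReal_re, Complex.re_ofReal_mul,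
    Complex.re_ofReal_mul, Complex.re_mul_ofReal, sq (a i), Complex.mul_re]
  ring

/-- The extra exponential factor is what differentiation in the parameter `a` requires. -/
lemma memLp_gaussianPacket_mul_exp (hħ : 0 < ħ) (hL : IsUnit L.det) (a b : Fin n → ℂ) (r : ℝ) :
    MemLp (fun x => ‖gaussianPacket ħ L Y a x‖ *
      Real.exp (r * ‖∑ i, b i * ((L⁻¹ *ᵥ x) i : ℝ)‖)) 2 := by
  have hw : Continuous fun x : Fin n → ℝ => ∑ i, b i * (((L⁻¹ *ᵥ x) i : ℝ) : ℂ) := by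
    have : Continuous fun x : Fin n → ℝ => L⁻¹ *ᵥ x :=
      continuous_const.matrix_mulVec continuous_id
    fun_prop
  have hcont : Continuous (fun x => ‖gaussianPacket ħ L Y a x‖ *
      Real.exp (r * ‖∑ i, b i * ((L⁻¹ *ᵥ x) i : ℝ)‖)) :=
    (continuous_gaussianPacket a).norm.mul (Real.continuous_exp.comp (hw.norm.const_mul r))
  rw [memLp_two_iff_integrable_sq hcont.aestronglyMeasurable]
  have hLi : IsUnit (L⁻¹).det := Matrix.isUnit_nonsing_inv_det L hL
  set D : ℝ := ∑ i, (2 * ħ * r ^ 2 * ‖b i‖ ^ 2 -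
    1 / (2 * ħ) * ((a i).re ^ 2 - (a i).im ^ 2)) with hD
  have hint := ((L⁻¹).mulVecCLE hLi).integrable_comp_addHaar_iff volume volume _ |>.2
    ((integrable_exp_neg_mul_sum_sq (b := 1 / (2 * ħ)) (by positivity)
      (fun i => 2 / ħ * (a i).re)).mul_const (Real.exp D))
  refine hint.mono' (hcont.pow 2).aestronglyMeasurable (Filter.Eventually.of_forall fun x => ?_)
  simp only [Matrix.mulVecCLE_apply]
  rw [Real.norm_of_nonneg (sq_nonneg _), norm_gaussianPacket, ← Real.exp_add, ← Real.exp_nat_mul,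
    ← Real.exp_add, Real.exp_le_exp]
  generalize L⁻¹ *ᵥ x = y
  have h1 : r * ‖∑ i, b i * (y i : ℂ)‖ ≤ ∑ i, (ħ * r ^ 2 * ‖b i‖ ^ 2 + 1 / (4 * ħ) * y i ^ 2) := by
    calc r * ‖∑ i, b i * (y i : ℂ)‖ ≤ |r| * ∑ i, ‖b i‖ * |y i| := by
          refine mul_le_mul (le_abs_self r) ?_ (norm_nonneg _) (abs_nonneg _)
          refine (norm_sum_le _ _).trans (le_of_eq ?_)
          simp
      _ = ∑ i, (|r| * ‖b i‖) * |y i| := by rw [Finset.mul_sum]; simp only [mul_assoc]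
      _ ≤ _ := by
          refine Finset.sum_le_sum fun i _ => ?_
          have h2 := sq_nonneg (2 * ħ * (|r| * ‖b i‖) - |y i|)
          rw [← sq_abs r, ← sq_abs (y i)]
          have h3 : ħ * |r| ^ 2 * ‖b i‖ ^ 2 + 1 / (4 * ħ) * |y i| ^ 2 - |r| * ‖b i‖ * |y i| =
            (2 * ħ * (|r| * ‖b i‖) - |y i|) ^ 2 / (4 * ħ) := by field_simp; ring
          have : 0 ≤ (2 * ħ * (|r| * ‖b i‖) - |y i|) ^ 2 / (4 * ħ) := by positivity
          linarith
  refine (mul_le_mul_of_nonneg_left (add_le_add_right h1 _) (by norm_num)).trans (le_of_eq ?_)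
  rw [hD, ← Finset.sum_add_distrib, Finset.mul_sum, Finset.mul_sum, ← Finset.sum_add_distrib,
    ← Finset.sum_add_distrib]
  refine Finset.sum_congr rfl fun i _ => ?_
  push_cast
  field_simp
  ring

lemma memLp_gaussianPacket (hħ : 0 < ħ) (hL : IsUnit L.det) (a : Fin n → ℂ) :
    MemLp (gaussianPacket ħ L Y a) 2 := by
  have := memLp_gaussianPacket_mul_exp (Y := Y) hħ hL a 0 0
  simp only [zero_mul, Real.exp_zero, mul_one] at this
  exact (memLp_norm_iff (continuous_gaussianPacket a).aestronglyMeasurable).1 this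

/-- Matrix elements with wave packets are entire along complex lines of parameters. -/
lemma differentiable_inner_gaussianPacket (hħ : 0 < ħ) (hL : IsUnit L.det) (f : L2Space n)
    (a b : Fin n → ℂ) :
    Differentiable ℂ fun ζ : ℂ =>
      inner ℂ f (memLp_gaussianPacket (Y := Y) hħ hL (a + ζ • b)).toLp := by
  set w : (Fin n → ℝ) → ℂ := fun x => ∑ i, (b i / ħ) * ((L⁻¹ *ᵥ x) i : ℝ) with hw
  have hwc : Continuous w := by
    have : Continuous fun x : Fin n → ℝ => L⁻¹ *ᵥ x :=
      continuous_const.matrix_mulVec continuous_id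
    fun_prop
  have hf := Lp.memLp f
  have key := differentiable_integral_mul_cexp (μ := volume)
    (φ := fun x => starRingEnd ℂ (f x) * gaussianPacket ħ L Y a x) (w := w)
    ((Complex.continuous_conj.comp_aestronglyMeasurable hf.1).mul
      (continuous_gaussianPacket a).aestronglyMeasurable) hwc.aestronglyMeasurable
    (fun r => by
      have := (memLp_gaussianPacket_mul_exp (Y := Y) hħ hL a (fun i => b i / ħ) r).integrable_mul
        hf.norm
      refine this.congr (Filter.Eventually.of_forall fun x => ?_)
      simp only [Pi.mul_apply, norm_mul, RCLike.norm_conj, hw]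
      ring)
  have hpoly : Differentiable ℂ fun ζ : ℂ => Complex.exp (-(1 / (4 * ħ)) *
      (2 * ζ * ∑ i, a i * b i + ζ ^ 2 * ∑ i, b i ^ 2)) := by fun_prop
  convert! hpoly.mul key using 1
  ext ζ
  rw [L2.inner_def, Pi.mul_apply, ← integral_const_mul]
  refine integral_congr_ae ?_
  filter_upwards [(memLp_gaussianPacket (Y := Y) hħ hL (a + ζ • b)).coeFn_toLp] with x hx
  rw [hx, RCLike.inner_apply]
  have : gaussianPacket ħ L Y (a + ζ • b) x = Complex.exp (-(1 / (4 * ħ)) *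
      (2 * ζ * ∑ i, a i * b i + ζ ^ 2 * ∑ i, b i ^ 2)) *
      (gaussianPacket ħ L Y a x * Complex.exp (ζ * w x)) := by
    rw [gaussianPacket, gaussianPacket, ← Complex.exp_add, ← Complex.exp_add]
    congr 1
    simp only [hw, Finset.mul_sum, ← Finset.sum_add_distrib, mul_add]
    rw [add_left_comm, add_assoc, add_right_inj, ← Finset.sum_add_distrib, ← Finset.sum_add_distrib]
    refine Finset.sum_congr rfl fun i _ => ?_
    simp only [Pi.add_apply, Pi.smul_apply, smul_eq_mul]
    ring
  rw [this]
  ring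

end Packet

/-! ### Wigner distributions tested against Gaussian wave packets -/

section Wigner

variable {n : ℕ} {ħ : ℝ} {L Y : Matrix (Fin n) (Fin n) ℝ}

lemma triangularMatrix_mulVec (z : PhaseSpace n) :
    triangularMatrix L Y *ᵥ z = phasePoint (L *ᵥ fun i => z (Sum.inl i))
      (-(Y *ᵥ L *ᵥ fun i => z (Sum.inl i)) + L⁻¹ *ᵥ fun i => z (Sum.inr i)) := by
  rw [triangularMatrix, Matrix.fromBlocks_mulVec, phasePoint]
  simp [Function.comp_def, Matrix.neg_mulVec]

/-- The linear coordinates `(z, s) ↦ (x, (y, p))` on the domain of the triple integral for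
`⟨g, T g⟩`: `s` is the rescaled difference `L⁻¹ (x - y)`, and the midpoint `((x + y) / 2, p)` is the
image of `z` under `triangularMatrix L Y`. -/
noncomputable def wignerCoordinates (hL : IsUnit L.det) (Y : Matrix (Fin n) (Fin n) ℝ) :
    (PhaseSpace n × (Fin n → ℝ)) ≃L[ℝ] (Fin n → ℝ) × ((Fin n → ℝ) × (Fin n → ℝ)) :=
  LinearEquiv.toContinuousLinearEquiv
    { toFun := fun q => (L *ᵥ (fun i => q.1 (Sum.inl i)) + (1 / 2 : ℝ) • L *ᵥ q.2,
        (L *ᵥ (fun i => q.1 (Sum.inl i)) - (1 / 2 : ℝ) • L *ᵥ q.2,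
          -(Y *ᵥ L *ᵥ fun i => q.1 (Sum.inl i)) + L⁻¹ *ᵥ fun i => q.1 (Sum.inr i)))
      invFun := fun r => (phasePoint (L⁻¹ *ᵥ ((1 / 2 : ℝ) • (r.1 + r.2.1)))
        (L *ᵥ (r.2.2 + Y *ᵥ ((1 / 2 : ℝ) • (r.1 + r.2.1)))), L⁻¹ *ᵥ (r.1 - r.2.1))
      map_add' := fun q q' => by
        have h1 : (fun i => (q + q').1 (Sum.inl i)) =
          (fun i => q.1 (Sum.inl i)) + fun i => q'.1 (Sum.inl i) := rfl
        have h2 : (fun i => (q + q').1 (Sum.inr i)) =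
          (fun i => q.1 (Sum.inr i)) + fun i => q'.1 (Sum.inr i) := rfl
        simp only [h1, h2, Prod.snd_add, Matrix.mulVec_add, Prod.mk_add_mk, smul_add]
        refine Prod.ext ?_ (Prod.ext ?_ ?_) <;> dsimp only <;> abel
      map_smul' := fun c q => by
        have h1 : (fun i => (c • q).1 (Sum.inl i)) = c • fun i => q.1 (Sum.inl i) := rfl
        have h2 : (fun i => (c • q).1 (Sum.inr i)) = c • fun i => q.1 (Sum.inr i) := rfl
        simp only [h1, h2, Prod.smul_snd, Matrix.mulVec_smul, Prod.smul_mk, RingHom.id_apply,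
          smul_add, smul_sub, smul_neg, smul_comm c (1 / 2 : ℝ)]
      left_inv := fun q => by
        have h1 : ∀ u v : Fin n → ℝ, (1 / 2 : ℝ) • (u + (1 / 2 : ℝ) • v +
          (u - (1 / 2 : ℝ) • v)) = u := fun u v => by ext i; simp; ring
        have h2 : ∀ u v : Fin n → ℝ, u + (1 / 2 : ℝ) • v - (u - (1 / 2 : ℝ) • v) = v :=
          fun u v => by ext i; simp; ring
        simp only [h1, h2, neg_add_cancel_comm, Matrix.mulVec_mulVec, Matrix.nonsing_inv_mul _ hL,
          Matrix.mul_nonsing_inv _ hL, Matrix.one_mulVec]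
        refine Prod.ext ?_ rfl
        ext (i | i) <;> rfl
      right_inv := fun r => by
        have h1 : ∀ u v : Fin n → ℝ, (1 / 2 : ℝ) • (u + v) + (1 / 2 : ℝ) • (u - v) = u :=
          fun u v => by ext i; simp; ring
        have h2 : ∀ u v : Fin n → ℝ, (1 / 2 : ℝ) • (u + v) - (1 / 2 : ℝ) • (u - v) = v :=
          fun u v => by ext i; simp; ring
        simp only [phasePoint, Sum.elim_inl, Sum.elim_inr, Matrix.mulVec_mulVec,
          Matrix.nonsing_inv_mul _ hL, Matrix.mul_nonsing_inv _ hL, Matrix.one_mulVec, h1, h2]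
        rw [neg_add_cancel_comm_assoc] }

lemma wignerCoordinates_apply (hL : IsUnit L.det) (q : PhaseSpace n × (Fin n → ℝ)) :
    wignerCoordinates hL Y q = (L *ᵥ (fun i => q.1 (Sum.inl i)) + (1 / 2 : ℝ) • L *ᵥ q.2,
        (L *ᵥ (fun i => q.1 (Sum.inl i)) - (1 / 2 : ℝ) • L *ᵥ q.2,
          -(Y *ᵥ L *ᵥ fun i => q.1 (Sum.inl i)) + L⁻¹ *ᵥ fun i => q.1 (Sum.inr i))) := rfl

/-- In the coordinates `(z, s)` with `z = (x, p)` the chirps cancel the shear of `p`, and the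
integrand of `⟨g, T g⟩` becomes a Gaussian in `x` times a Gaussian in `s` with phase
`(p - Im a) · s / ħ`. -/
lemma conj_gaussianPacket_mul_gaussianPacket (hħ : 0 < ħ) (hL : IsUnit L.det) (hLT : Lᵀ = L)
    (hY : Yᵀ = Y) (a : Fin n → ℂ) (x p s : Fin n → ℝ) :
    starRingEnd ℂ (gaussianPacket ħ L Y a (L *ᵥ x + (1 / 2 : ℝ) • L *ᵥ s)) *
      (Complex.exp (Complex.I / ħ * (((-(Y *ᵥ L *ᵥ x) + L⁻¹ *ᵥ p) ⬝ᵥ (L *ᵥ s) : ℝ) : ℂ)) *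
        gaussianPacket ħ L Y a (L *ᵥ x - (1 / 2 : ℝ) • L *ᵥ s)) =
      ((Real.exp (∑ i, (-(1 / ħ) * (x i - (a i).re) ^ 2 +
        1 / (2 * ħ) * ((a i).re ^ 2 + (a i).im ^ 2))) : ℝ) : ℂ) *
      Complex.exp (-((1 / (4 * ħ) : ℝ) : ℂ) * ∑ i, (s i : ℂ) ^ 2 +
        ∑ i, Complex.I / ħ * (p i - (a i).im) * s i) := by
  have hinv : ∀ u : Fin n → ℝ, L⁻¹ *ᵥ L *ᵥ u = u := fun u => by
    rw [Matrix.mulVec_mulVec, Matrix.nonsing_inv_mul _ hL, Matrix.one_mulVec]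
  have hp : (L⁻¹ *ᵥ p) ⬝ᵥ (L *ᵥ s) = p ⬝ᵥ s := by
    rw [Matrix.dotProduct_mulVec, ← Matrix.mulVec_transpose, hLT, Matrix.mulVec_mulVec,
      Matrix.mul_nonsing_inv _ hL, Matrix.one_mulVec]
  have hYc : (Y *ᵥ L *ᵥ s) ⬝ᵥ (L *ᵥ x) = (Y *ᵥ L *ᵥ x) ⬝ᵥ (L *ᵥ s) := by
    rw [dotProduct_comm, Matrix.dotProduct_mulVec, ← Matrix.mulVec_transpose, hY]
  have hphase : -(starRingEnd ℂ (Complex.I / (2 * ħ))) *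
      (((Y *ᵥ (L *ᵥ x + (1 / 2 : ℝ) • L *ᵥ s)) ⬝ᵥ (L *ᵥ x + (1 / 2 : ℝ) • L *ᵥ s) : ℝ) : ℂ) +
      (Complex.I / ħ * (((-(Y *ᵥ L *ᵥ x) + L⁻¹ *ᵥ p) ⬝ᵥ (L *ᵥ s) : ℝ) : ℂ) +
      -(Complex.I / (2 * ħ)) *
      (((Y *ᵥ (L *ᵥ x - (1 / 2 : ℝ) • L *ᵥ s)) ⬝ᵥ (L *ᵥ x - (1 / 2 : ℝ) • L *ᵥ s) : ℝ) : ℂ)) =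
      Complex.I / ħ * ∑ i, (p i : ℂ) * s i := by
    have h1 : (p ⬝ᵥ s : ℝ) = ∑ i, p i * s i := rfl
    have h2 : ∑ i, (p i : ℂ) * s i = ((p ⬝ᵥ s : ℝ) : ℂ) := by rw [h1]; push_cast; rfl
    have h3 : starRingEnd ℂ (Complex.I / (2 * ħ)) = -(Complex.I / (2 * ħ)) := by
      rw [map_div₀, Complex.conj_I, map_mul, Complex.conj_ofReal, Complex.conj_ofNat, neg_div]
    rw [h2, h3]
    simp only [Matrix.mulVec_add, Matrix.mulVec_sub, Matrix.mulVec_smul, add_dotProduct,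
      dotProduct_add, sub_dotProduct, dotProduct_sub, smul_dotProduct, dotProduct_smul, hYc,
      neg_dotProduct, hp, smul_eq_mul]
    push_cast
    field_simp
    ring
  rw [Complex.ofReal_exp, gaussianPacket, gaussianPacket, ← Complex.exp_conj, ← Complex.exp_add,
    ← Complex.exp_add, ← Complex.exp_add]
  congr 1
  simp only [map_add, map_mul, map_neg, map_sum, map_sub, map_pow, map_div₀, Complex.conj_ofReal,
    Complex.conj_I, Complex.conj_ofNat, map_one,
    Matrix.mulVec_add, Matrix.mulVec_sub, Matrix.mulVec_smul, hinv] at hphase ⊢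
  have hsum : (∑ i, (-(1 / (2 * (ħ : ℂ))) * (((x + (1 / 2 : ℝ) • s) i : ℝ) : ℂ) ^ 2 +
        1 / (ħ : ℂ) * (starRingEnd ℂ (a i) * (((x + (1 / 2 : ℝ) • s) i : ℝ) : ℂ)) -
        1 / (4 * (ħ : ℂ)) * starRingEnd ℂ (a i) ^ 2)) +
      (∑ i, (-(1 / (2 * (ħ : ℂ))) * (((x - (1 / 2 : ℝ) • s) i : ℝ) : ℂ) ^ 2 +
        1 / (ħ : ℂ) * (a i * (((x - (1 / 2 : ℝ) • s) i : ℝ) : ℂ)) -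
        1 / (4 * (ħ : ℂ)) * a i ^ 2)) + Complex.I / ħ * ∑ i, (p i : ℂ) * s i =
      ((∑ i, (-(1 / ħ) * (x i - (a i).re) ^ 2 +
        1 / (2 * ħ) * ((a i).re ^ 2 + (a i).im ^ 2)) : ℝ) : ℂ) +
      (-((1 / (4 * ħ) : ℝ) : ℂ) * ∑ i, (s i : ℂ) ^ 2 +
        ∑ i, Complex.I / ħ * (p i - (a i).im) * s i) := by
    push_cast
    simp only [Finset.mul_sum]
    simp only [← Finset.sum_add_distrib]
    refine Finset.sum_congr rfl fun i _ => ?_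
    have ha : a i = (a i).re + (a i).im * Complex.I := (Complex.re_add_im _).symm
    have hac : starRingEnd ℂ (a i) = (a i).re - (a i).im * Complex.I := by
      apply Complex.ext <;> simp
    have hħ' : (ħ : ℂ) ≠ 0 := by exact_mod_cast hħ.ne'
    rw [hac]
    generalize (a i).re = α at *
    generalize (a i).im = β at *
    rw [ha]
    simp only [Pi.add_apply, Pi.sub_apply, Pi.smul_apply, smul_eq_mul]
    push_cast
    field_simp
    ring_nf
    simp only [Complex.I_sq]
    ring
  linear_combination hphase + hsum

lemma exists_integral_gaussian_eq (hħ : 0 < ħ) :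
    ∃ κ : ℝ, 0 < κ ∧ ∀ q : Fin n → ℝ,
      ∫ s : Fin n → ℝ, Complex.exp (-((1 / (4 * ħ) : ℝ) : ℂ) * ∑ i, (s i : ℂ) ^ 2 +
        ∑ i, Complex.I / ħ * q i * s i) = ((κ * Real.exp (-(1 / ħ) * ∑ i, q i ^ 2) : ℝ) : ℂ) := by
  have hb : 0 < 1 / (4 * ħ) := by positivity
  refine ⟨(Real.pi / (1 / (4 * ħ))) ^ ((n : ℝ) / 2), by positivity, fun q => ?_⟩
  rw [GaussianFourier.integral_cexp_neg_mul_sum_add (by rwa [Complex.ofReal_re]),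
    Complex.ofReal_mul, Complex.ofReal_cpow (by positivity), Complex.ofReal_exp, Fintype.card_fin]
  have hħ' : (ħ : ℂ) ≠ 0 := by exact_mod_cast hħ.ne'
  congr 2
  · push_cast; rfl
  · push_cast; rfl
  · push_cast
    rw [Finset.sum_div, Finset.mul_sum]
    refine Finset.sum_congr rfl fun i _ => ?_
    field_simp
    simp only [Complex.I_sq]
    ring

lemma dotProduct_sub_packetCenter (a : Fin n → ℂ) (z : PhaseSpace n) :
    (z - packetCenter a) ⬝ᵥ (z - packetCenter a) =
      ∑ i, (z (Sum.inl i) - (a i).re) ^ 2 + ∑ i, (z (Sum.inr i) - (a i).im) ^ 2 := by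
  simp [dotProduct, Fintype.sum_sum_type, packetCenter, phasePoint, sq]

lemma dotProduct_packetCenter (a : Fin n → ℂ) :
    packetCenter a ⬝ᵥ packetCenter a = ∑ i, ((a i).re ^ 2 + (a i).im ^ 2) := by
  simp [dotProduct, Fintype.sum_sum_type, packetCenter, phasePoint, sq, Finset.sum_add_distrib]

lemma integrable_mul_exp_neg_sq {f : PhaseSpace n → ℝ} (hf : Integrable f) (hħ : 0 < ħ)
    (w : PhaseSpace n) :
    Integrable fun z => f z * Real.exp (-(1 / ħ) * ((z - w) ⬝ᵥ (z - w))) := by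
  have hc : Continuous fun z : PhaseSpace n => Real.exp (-(1 / ħ) * ((z - w) ⬝ᵥ (z - w))) := by
    have : Continuous fun z : PhaseSpace n => (z - w) ⬝ᵥ (z - w) := by fun_prop
    fun_prop
  refine hf.mul_bdd (c := 1) hc.aestronglyMeasurable (Filter.Eventually.of_forall fun z => ?_)
  rw [Real.norm_of_nonneg (Real.exp_pos _).le, Real.exp_le_one_iff, neg_mul, neg_nonpos]
  have : 0 ≤ (z - w) ⬝ᵥ (z - w) := Finset.sum_nonneg fun i _ => mul_self_nonneg _
  positivity

/-- The expectation of an operator with Wigner distribution `ρ` in a wave packet is, up to the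
square norm of the packet, the integral of `ρ` against the Wigner function of the packet: a
positive Gaussian around the centre. The constant `κ` does not depend on `a`. -/
lemma IsWignerDistribution.exists_inner_gaussianPacket_eq {ρ : PhaseSpace n → ℝ}
    {T : L2Space n →L[ℂ] L2Space n} (hT : IsWignerDistribution ħ ρ T) (hρ : Integrable ρ)
    (hħ : 0 < ħ) (hL : IsUnit L.det) (hLT : Lᵀ = L) (hY : Yᵀ = Y)
    (hS : IsUnit (triangularMatrix L Y).det) :
    ∃ κ : ℝ, 0 < κ ∧ ∀ a : Fin n → ℂ,
      inner ℂ (memLp_gaussianPacket (Y := Y) hħ hL a).toLp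
        (T (memLp_gaussianPacket (Y := Y) hħ hL a).toLp) =
      ((κ * (Real.exp (1 / (2 * ħ) * (packetCenter a ⬝ᵥ packetCenter a)) *
        ∫ z, ρ (triangularMatrix L Y *ᵥ z) *
          Real.exp (-(1 / ħ) * ((z - packetCenter a) ⬝ᵥ (z - packetCenter a))) : ℝ) : ℝ) : ℂ) := by
  have hV2 : (volume : Measure ((Fin n → ℝ) × (Fin n → ℝ))).IsAddHaarMeasure :=
    Measure.prod.instIsAddHaarMeasure volume volume
  have hV3 : (volume : Measure ((Fin n → ℝ) × ((Fin n → ℝ) × (Fin n → ℝ)))).IsAddHaarMeasure :=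
    Measure.prod.instIsAddHaarMeasure volume volume
  have hV1 : (volume : Measure (PhaseSpace n × (Fin n → ℝ))).IsAddHaarMeasure :=
    Measure.prod.instIsAddHaarMeasure volume volume
  obtain ⟨k, hk, hchange⟩ :=
    (wignerCoordinates hL Y).exists_integral_eq_smul_integral_comp volume volume ℂ
  obtain ⟨κ, hκ, hgauss⟩ := exists_integral_gaussian_eq (n := n) hħ
  refine ⟨k * κ, mul_pos hk hκ, fun a => ?_⟩
  set g := gaussianPacket ħ L Y a with hg
  set S := triangularMatrix L Y with hSdef
  set f : (Fin n → ℝ) × ((Fin n → ℝ) × (Fin n → ℝ)) → ℂ := fun r =>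
    starRingEnd ℂ (g r.1) * (Complex.exp (Complex.I / ħ * ((r.2.2 ⬝ᵥ (r.1 - r.2.1) : ℝ) : ℂ)) *
        (ρ (phasePoint ((1 / 2 : ℝ) • (r.1 + r.2.1)) r.2.2) : ℂ) * g r.2.1) with hf
  set E : PhaseSpace n → ℝ := fun z => Real.exp (∑ i, (-(1 / ħ) * (z (Sum.inl i) - (a i).re) ^ 2 +
        1 / (2 * ħ) * ((a i).re ^ 2 + (a i).im ^ 2))) with hE
  set γ : PhaseSpace n → (Fin n → ℝ) → ℂ := fun z s =>
    Complex.exp (-((1 / (4 * ħ) : ℝ) : ℂ) * ∑ i, (s i : ℂ) ^ 2 +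
        ∑ i, Complex.I / ħ * (((fun i => z (Sum.inr i) - (a i).im) i : ℝ) : ℂ) * s i) with hγ
  have hfe : ∀ q, f (wignerCoordinates hL Y q) = ((ρ (S *ᵥ q.1) * E q.1 : ℝ) : ℂ) * γ q.1 q.2 := by
    rintro ⟨z, s⟩
    have h1 : ∀ u v : Fin n → ℝ, (1 / 2 : ℝ) • (u + (1 / 2 : ℝ) • v +
      (u - (1 / 2 : ℝ) • v)) = u := fun u v => by ext i; simp; ring
    have h2 : ∀ u v : Fin n → ℝ, u + (1 / 2 : ℝ) • v - (u - (1 / 2 : ℝ) • v) = v :=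
      fun u v => by ext i; simp; ring
    have h3 := conj_gaussianPacket_mul_gaussianPacket hħ hL hLT hY a (fun i => z (Sum.inl i))
      (fun i => z (Sum.inr i)) s
    simp only [hf, wignerCoordinates_apply, h1, h2, ← triangularMatrix_mulVec]
    rw [mul_right_comm (Complex.exp _), ← mul_assoc, hg, h3, hE, hγ]
    push_cast
    ring
  have hρS : Integrable fun z => ρ (S *ᵥ z) :=
    (S.mulVecCLE hS).integrable_comp_addHaar_iff volume volume ρ |>.2 hρ
  have hEc : Continuous E := by rw [hE]; fun_prop
  have hρE : Integrable fun z => ρ (S *ᵥ z) * E z := by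
    refine hρS.mul_bdd (c := Real.exp (∑ i, 1 / (2 * ħ) * ((a i).re ^ 2 + (a i).im ^ 2)))
      hEc.aestronglyMeasurable (Filter.Eventually.of_forall fun z => ?_)
    rw [Real.norm_of_nonneg (Real.exp_pos _).le, Real.exp_le_exp]
    refine Finset.sum_le_sum fun i _ => ?_
    have : 0 ≤ 1 / ħ * (z (Sum.inl i) - (a i).re) ^ 2 := by positivity
    linarith
  have hγc : Continuous fun q : PhaseSpace n × (Fin n → ℝ) => γ q.1 q.2 := by rw [hγ]; fun_prop
  have hfeint : Integrable fun q => f (wignerCoordinates hL Y q) := by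
    simp only [hfe]
    have h1 := hρE.norm.mul_prod (integrable_exp_neg_mul_sum_sq (m := Fin n) (b := 1 / (4 * ħ))
      (by positivity) 0)
    refine h1.mono' ?_ (Filter.Eventually.of_forall fun q => ?_)
    · exact (Complex.continuous_ofReal.comp_aestronglyMeasurable hρE.1.comp_fst).mul
        hγc.aestronglyMeasurable
    · rw [norm_mul, Complex.norm_real]
      refine mul_le_mul_of_nonneg_left (le_of_eq ?_) (norm_nonneg _)
      rw [hγ, Complex.norm_exp]
      congr 1
      have h2 : -((1 / (4 * ħ) : ℝ) : ℂ) * ∑ i, (q.2 i : ℂ) ^ 2 +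
          ∑ i, Complex.I / ħ * (((fun i => q.1 (Sum.inr i) - (a i).im) i : ℝ) : ℂ) * q.2 i =
          ((-(1 / (4 * ħ)) * ∑ i, q.2 i ^ 2 : ℝ) : ℂ) +
          ((∑ i, 1 / ħ * (q.1 (Sum.inr i) - (a i).im) * q.2 i : ℝ) : ℂ) * Complex.I := by
        push_cast
        rw [Finset.sum_mul]
        congr 1
        refine Finset.sum_congr rfl fun i _ => ?_
        ring
      rw [h2, Complex.add_re, Complex.ofReal_re, Complex.re_ofReal_mul, Complex.I_re]
      simp
  have hfint : Integrable f :=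
    (wignerCoordinates hL Y).integrable_comp_addHaar_iff volume volume f |>.1 hfeint
  have hinner : inner ℂ (memLp_gaussianPacket (Y := Y) hħ hL a).toLp
      (T (memLp_gaussianPacket (Y := Y) hħ hL a).toLp) = ∫ r, f r := by
    rw [L2.inner_def, Measure.volume_eq_prod, integral_prod _ hfint]
    refine integral_congr_ae ?_
    have hae := (memLp_gaussianPacket (Y := Y) hħ hL a).coeFn_toLp
    filter_upwards [hae, hT (memLp_gaussianPacket (Y := Y) hħ hL a).toLp] with x hx hTx
    rw [hTx, hx, RCLike.inner_apply, mul_comm, ← integral_const_mul]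
    refine integral_congr_ae ?_
    have hae2 : ∀ᵐ w : (Fin n → ℝ) × (Fin n → ℝ),
        ((memLp_gaussianPacket (Y := Y) hħ hL a).toLp : L2Space n) w.1 = g w.1 :=
      Measure.quasiMeasurePreserving_fst.ae hae
    filter_upwards [hae2] with w hw
    rw [hw]
  rw [hinner, hchange]
  simp only [hfe] at hfeint ⊢
  rw [Measure.volume_eq_prod, integral_prod _ hfeint]
  simp only [integral_const_mul, hγ, hgauss]
  rw [← integral_const_mul, ← integral_const_mul, Complex.real_smul, ← integral_const_mul,
    ← integral_complex_ofReal]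
  refine integral_congr_ae (Filter.Eventually.of_forall fun z => ?_)
  simp only [← Complex.ofReal_mul]
  congr 1
  rw [dotProduct_sub_packetCenter, dotProduct_packetCenter, hE]
  have h1 : Real.exp (∑ i, (-(1 / ħ) * (z (Sum.inl i) - (a i).re) ^ 2 +
        1 / (2 * ħ) * ((a i).re ^ 2 + (a i).im ^ 2))) *
        Real.exp (-(1 / ħ) * ∑ i, (z (Sum.inr i) - (a i).im) ^ 2) =
      Real.exp (1 / (2 * ħ) * ∑ i, ((a i).re ^ 2 + (a i).im ^ 2)) *
        Real.exp (-(1 / ħ) * (∑ i, (z (Sum.inl i) - (a i).re) ^ 2 +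
          ∑ i, (z (Sum.inr i) - (a i).im) ^ 2)) := by
    rw [← Real.exp_add, ← Real.exp_add, Finset.sum_add_distrib, ← Finset.mul_sum, ← Finset.mul_sum]
    ring_nf
  linear_combination (k * κ * ρ (S *ᵥ z)) * h1

end Wigner

/-! ### Vanishing of the packet expectations -/

lemma exists_packetCenter_eq {n : ℕ} (w : PhaseSpace n) : ∃ a : Fin n → ℂ, packetCenter a = w :=
  ⟨fun i => ⟨w (Sum.inl i), w (Sum.inr i)⟩, by ext (i | i) <;> rfl⟩

lemma packetCenter_add_smul {n : ℕ} (a b : Fin n → ℂ) (ζ : ℂ) :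
    packetCenter (a + ζ • b) = packetCenter a + ζ.re • packetCenter b +
      ζ.im • Matrix.J (Fin n) ℝ *ᵥ packetCenter b := by
  have hJ : Matrix.J (Fin n) ℝ *ᵥ packetCenter b =
      phasePoint (fun i => -(b i).im) (fun i => (b i).re) := by
    rw [Matrix.J, Matrix.fromBlocks_mulVec]
    ext (i | i) <;> simp [packetCenter, phasePoint, Matrix.neg_mulVec, Function.comp_def]
  rw [hJ]
  ext (i | i) <;> simp [packetCenter, phasePoint] <;> ring

lemma integrable_exp_neg_sq {n : ℕ} {ħ : ℝ} (hħ : 0 < ħ) :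
    Integrable fun z : PhaseSpace n => Real.exp (-(1 / ħ) * (z ⬝ᵥ z)) := by
  have := integrable_exp_neg_mul_sum_sq (m := Fin n ⊕ Fin n) (b := 1 / ħ) (by positivity) 0
  simpa [dotProduct, sq] using this

/-- A function with vanishing Gaussian convolution has integral zero, since integrals multiply under
convolution. -/
lemma integral_eq_zero_of_forall_integral_mul_exp_eq_zero {n : ℕ} {ħ : ℝ} (hħ : 0 < ħ)
    {f : PhaseSpace n → ℝ} (hf : Integrable f)
    (h : ∀ w, ∫ z, f z * Real.exp (-(1 / ħ) * ((z - w) ⬝ᵥ (z - w))) = 0) : ∫ z, f z = 0 := by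
  set g : PhaseSpace n → ℝ := fun z => Real.exp (-(1 / ħ) * (z ⬝ᵥ z)) with hg
  have hgi : Integrable g := integrable_exp_neg_sq hħ
  have hconv := integral_convolution (ContinuousLinearMap.mul ℝ ℝ) hf hgi
  have hzero : ∀ w, convolution f g (ContinuousLinearMap.mul ℝ ℝ) volume w = 0 := by
    intro w
    rw [convolution_def, ← h w]
    refine integral_congr_ae (Filter.Eventually.of_forall fun z => ?_)
    simp only [hg, ContinuousLinearMap.mul_apply']
    rw [← neg_sub z w, neg_dotProduct_neg]
  simp only [hzero, integral_zero, ContinuousLinearMap.mul_apply'] at hconv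
  exact (mul_eq_zero.1 hconv.symm).resolve_right (integral_exp_pos hgi).ne'

/-- If `ρ` has, in the triangular coordinates, a Gaussian majorant whose matrix `K` commutes with
`J` and has an eigenvalue `μ > 1`, then the expectation of `T` vanishes in all wave packets. The
eigenvector `v` spans with `J v` a complex line of parameters; along it the expectation of `T` has
Gaussian decay, hence so does the entire function `ζ ↦ ⟨T ψ, g⟩`, which is therefore zero. -/
lemma IsWignerDistribution.inner_gaussianPacket_eq_zero {n : ℕ} {ħ : ℝ}
    {L Y : Matrix (Fin n) (Fin n) ℝ} {ρ : PhaseSpace n → ℝ}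
    {T : L2Space n →L[ℂ] L2Space n} (hT : IsWignerDistribution ħ ρ T) (hTpos : T.IsPositive)
    (hρ : Integrable ρ) (hħ : 0 < ħ) (hL : IsUnit L.det) (hLT : Lᵀ = L) (hY : Yᵀ = Y)
    (hS : IsUnit (triangularMatrix L Y).det)
    {K : Matrix (Fin n ⊕ Fin n) (Fin n ⊕ Fin n) ℝ} (hK : K.PosDef)
    (hKJ : Commute K (Matrix.J (Fin n) ℝ)) {C : ℝ} (hC : 0 ≤ C)
    (hbound : ∀ z, ρ (triangularMatrix L Y *ᵥ z) ≤ C * Real.exp (-(1 / ħ) * ((K *ᵥ z) ⬝ᵥ z)))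
    {μ : ℝ} (hμ : 1 < μ) {v : PhaseSpace n} (hvv : v ⬝ᵥ v = 1) (hKv : K *ᵥ v = μ • v)
    (a : Fin n → ℂ) :
    inner ℂ (memLp_gaussianPacket (Y := Y) hħ hL a).toLp
        (T (memLp_gaussianPacket (Y := Y) hħ hL a).toLp) = 0 := by
  set G : (Fin n → ℂ) → L2Space n := fun a => (memLp_gaussianPacket (Y := Y) hħ hL a).toLp with hG
  change inner ℂ (G a) (T (G a)) = 0
  obtain ⟨κ, hκ, hdiag⟩ := hT.exists_inner_gaussianPacket_eq hρ hħ hL hLT hY hS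
  have hρS : Integrable fun z => ρ (triangularMatrix L Y *ᵥ z) :=
    ((triangularMatrix L Y).mulVecCLE hS).integrable_comp_addHaar_iff volume volume ρ |>.2 hρ
  set J := Matrix.J (Fin n) ℝ with hJdef
  have hJT : Jᵀ = -J := Matrix.J_transpose _ ℝ
  have hJJ : J * J = -1 := Matrix.J_squared _ ℝ
  set v' : PhaseSpace n := J *ᵥ v with hv'
  have hKv' : K *ᵥ v' = μ • v' := by
    rw [hv', Matrix.mulVec_mulVec, hKJ.eq, ← Matrix.mulVec_mulVec, hKv, Matrix.mulVec_smul]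
  have hJdot : ∀ x y : PhaseSpace n, (J *ᵥ x) ⬝ᵥ y = -(x ⬝ᵥ (J *ᵥ y)) := fun x y => by
    rw [Matrix.dotProduct_mulVec, ← Matrix.mulVec_transpose, hJT, Matrix.neg_mulVec,
      neg_dotProduct, neg_neg]
  have hvv' : v' ⬝ᵥ v' = 1 := by
    rw [hv', hJdot, Matrix.mulVec_mulVec, hJJ, Matrix.neg_mulVec, Matrix.one_mulVec,
      dotProduct_neg, neg_neg, hvv]
  have h0 : v ⬝ᵥ v' = 0 := by
    have := hJdot v v
    rw [dotProduct_comm, ← hv'] at this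
    linarith
  -- The complex line through `a` in the direction of `v`; its base point is orthogonal to `v`
  -- and `J v`.
  obtain ⟨b, hb⟩ := exists_packetCenter_eq v
  set ζ₀ : ℂ := ⟨packetCenter a ⬝ᵥ v, packetCenter a ⬝ᵥ v'⟩ with hζ₀
  set a₀ : Fin n → ℂ := a + (-ζ₀) • b with ha₀
  have haζ₀ : a₀ + ζ₀ • b = a := by rw [ha₀, neg_smul, neg_add_cancel_right]
  set u := packetCenter a₀ with hu
  have hue : u = packetCenter a + (-(packetCenter a ⬝ᵥ v)) • v +
      (-(packetCenter a ⬝ᵥ v')) • v' := by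
    rw [hu, ha₀, packetCenter_add_smul, hb]
    rfl
  have huv : u ⬝ᵥ v = 0 := by
    rw [hue, add_dotProduct, add_dotProduct, smul_dotProduct, smul_dotProduct, hvv,
      dotProduct_comm v' v, h0]
    simp
  have huv' : u ⬝ᵥ v' = 0 := by
    rw [hue, add_dotProduct, add_dotProduct, smul_dotProduct, smul_dotProduct, hvv', h0]
    simp
  set δ : ℝ := (μ - 1) / (2 * (1 + μ)) with hδ
  have hδpos : 0 < δ := div_pos (by linarith) (by linarith)
  set Γ : ℝ := ∫ z : PhaseSpace n, Real.exp (-(1 / ħ) * (z ⬝ᵥ z)) with hΓ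
  have hdecay : ∀ ζ : ℂ, (inner ℂ (G (a₀ + ζ • b)) (T (G (a₀ + ζ • b)))).re ≤
      κ * (C * Γ * Real.exp (1 / (2 * ħ) * (u ⬝ᵥ u))) * Real.exp (-(δ / ħ) * ‖ζ‖ ^ 2) := by
    intro ζ
    have hW : packetCenter (a₀ + ζ • b) = u + ζ.re • v + ζ.im • v' := by
      rw [packetCenter_add_smul, hb]
    rw [hG, hdiag, Complex.ofReal_re, hW, mul_assoc κ]
    refine mul_le_mul_of_nonneg_left ?_ hκ.le
    obtain ⟨z₀, hz₀⟩ := exists_sq_add_le_quadForm_add_sq hK hμ hKv hKv' hvv hvv' h0 huv huv'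
      ζ.re ζ.im
    rw [← hδ] at hz₀
    set w := u + ζ.re • v + ζ.im • v'
    have hnorm : ‖ζ‖ ^ 2 = ζ.re ^ 2 + ζ.im ^ 2 := by
      rw [Complex.sq_norm, Complex.normSq_apply]; ring
    have hint : ∫ z, ρ (triangularMatrix L Y *ᵥ z) *
        Real.exp (-(1 / ħ) * ((z - w) ⬝ᵥ (z - w))) ≤
        C * Real.exp (-(1 / ħ) * ((w ⬝ᵥ w - u ⬝ᵥ u) / 2 + δ * ‖ζ‖ ^ 2)) * Γ := by
      have hΓ' : Γ = ∫ z : PhaseSpace n, Real.exp (-(1 / ħ) * ((z - z₀) ⬝ᵥ (z - z₀))) :=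
        (integral_sub_right_eq_self
          (fun z : PhaseSpace n => Real.exp (-(1 / ħ) * (z ⬝ᵥ z))) z₀).symm
      rw [hΓ', ← integral_const_mul]
      refine integral_mono (integrable_mul_exp_neg_sq hρS hħ w)
        (((integrable_exp_neg_sq hħ).comp_sub_right z₀).const_mul _) fun z => ?_
      refine (mul_le_mul_of_nonneg_right (hbound z) (Real.exp_pos _).le).trans ?_
      rw [mul_assoc, mul_assoc, ← Real.exp_add, ← Real.exp_add]
      refine mul_le_mul_of_nonneg_left (Real.exp_le_exp.2 ?_) hC
      have := mul_le_mul_of_nonneg_left (hz₀ z) (one_div_pos.2 hħ).le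
      rw [hnorm]
      linarith
    refine (mul_le_mul_of_nonneg_left hint (Real.exp_pos _).le).trans (le_of_eq ?_)
    have hexp : Real.exp (1 / (2 * ħ) * (w ⬝ᵥ w)) *
        Real.exp (-(1 / ħ) * ((w ⬝ᵥ w - u ⬝ᵥ u) / 2 + δ * ‖ζ‖ ^ 2)) =
        Real.exp (1 / (2 * ħ) * (u ⬝ᵥ u)) * Real.exp (-(δ / ħ) * ‖ζ‖ ^ 2) := by
      rw [← Real.exp_add, ← Real.exp_add]
      congr 1
      field_simp
      ring
    linear_combination (C * Γ) * hexp
  have hF := (differentiable_inner_gaussianPacket (Y := Y) hħ hL (T (G a)) a₀ b)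
  have hzero := hF.eq_zero_of_gaussian_decay (κ := δ / ħ)
    (A := (inner ℂ (G a) (T (G a))).re * (κ * (C * Γ * Real.exp (1 / (2 * ħ) * (u ⬝ᵥ u)))))
    (by positivity) (fun ζ => ?_) ζ₀
  · change inner ℂ (T (G a)) (G (a₀ + ζ₀ • b)) = 0 at hzero
    rwa [haζ₀, hTpos.inner_left_eq_inner_right] at hzero
  · refine (hTpos.norm_inner_sq_le (G a) (G (a₀ + ζ • b))).trans ?_
    rw [mul_assoc]
    exact mul_le_mul_of_nonneg_left (hdecay ζ) (hTpos.re_inner_nonneg_right _)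

theorem theorem4 (n : ℕ) (ħ : ℝ) (hħ : 0 < ħ)
    (c : Set (PhaseSpace n) → ℝ≥0∞) (hc : IsLinearSymplecticCapacity c)
    (M : Matrix (Fin n ⊕ Fin n) (Fin n ⊕ Fin n) ℝ) (hM : M.PosDef)
    (ρ : PhaseSpace n → ℝ) (hρ : ContDiff ℝ ∞ ρ) (hint : Integrable ρ) (hone : ∫ z, ρ z = 1)
    (C : ℝ) (hC : 0 ≤ C) (hbound : ∀ z, ρ z ≤ C * Real.exp (-(1 / ħ) * quadForm M z))
    (hcap : c (phaseEllipsoid ħ M) < ENNReal.ofReal (1 / 2 * (2 * Real.pi * ħ))) :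
    ¬ ∃ T : L2Space n →L[ℂ] L2Space n, IsDensityOperator T ∧ IsWignerDistribution ħ ρ T := by
  rintro ⟨T, ⟨hTpos, -⟩, hT⟩
  obtain ⟨L, Y, hL, hY, hS, hKJ⟩ := exists_triangularMatrix_mem_symplecticGroup hM
  have hLT : Lᵀ = L := by simpa using hL.isHermitian.eq
  have hLu : IsUnit L.det := (Matrix.isUnit_iff_isUnit_det _).1 hL.isUnit
  have hSu : IsUnit (triangularMatrix L Y).det := SymplecticGroup.symplectic_det hS
  have hK : ((triangularMatrix L Y)ᵀ * M * triangularMatrix L Y).PosDef := by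
    have := hM.conjTranspose_mul_mul_same
      (Matrix.mulVec_injective_of_isUnit ((Matrix.isUnit_iff_isUnit_det _).2 hSu))
    simpa using this
  obtain ⟨μ, v, hμ, hvv, hKv⟩ := exists_eigenvector_of_capacity_lt hħ hc hM hS
    (by rwa [show 1 / 2 * (2 * Real.pi * ħ) = Real.pi * ħ by ring] at hcap)
  have hboundS : ∀ z, ρ (triangularMatrix L Y *ᵥ z) ≤ C * Real.exp (-(1 / ħ) *
      ((((triangularMatrix L Y)ᵀ * M * triangularMatrix L Y) *ᵥ z) ⬝ᵥ z)) := fun z => by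
    rw [← quadForm_mulVec]
    exact hbound _
  obtain ⟨κ, hκ, hdiag⟩ := hT.exists_inner_gaussianPacket_eq hint hħ hLu hLT hY hSu
  have hρS : ∫ z, ρ (triangularMatrix L Y *ᵥ z) = 0 := by
    refine integral_eq_zero_of_forall_integral_mul_exp_eq_zero hħ
      (((triangularMatrix L Y).mulVecCLE hSu).integrable_comp_addHaar_iff volume volume ρ |>.2 hint)
      fun w => ?_
    obtain ⟨a, rfl⟩ := exists_packetCenter_eq w
    have h := hT.inner_gaussianPacket_eq_zero hTpos hint hħ hLu hLT hY hSu hK hKJ hC hboundS hμ hvv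
      hKv a
    rw [hdiag, Complex.ofReal_eq_zero] at h
    exact ((mul_eq_zero.1 h).resolve_left hκ.ne' |> mul_eq_zero.1).resolve_left (Real.exp_pos _).ne'
  obtain ⟨k, -, hk⟩ :=
    ((triangularMatrix L Y).mulVecCLE hSu).exists_integral_eq_smul_integral_comp volume volume ℝ
  have h := hk ρ
  simp only [Matrix.mulVecCLE_apply, hρS, smul_zero, hone] at h
  exact one_ne_zero h
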